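/- **Languages and algebras.** Fix an LE-language $\mathcal L=\mathcal L_{\mathrm{LE}}(\mathcal F,\mathcal G)$: propositional variables $p_0,p_1,\dots$, lattice connectives $\bot,\top,\wedge,\vee$, and disjoint families $\mathcal F=\mathcal F_n\uplus\mathcal F_r$, $\mathcal G=\mathcal G_n\uplus\mathcal G_r$ of normal and regular connectives $h$ of finite arity $n_h$, each with an order-type $\varepsilon_h\in\{1,\partial\}^{n_h}$; regular connectives are unary. An $\mathcal L$-algebra is a bounded lattice $\mathbb A$ with operations such that every $f\in\mathcal F$, in each coordinate, preserves binary joins (if $\varepsilon_f(i)=1$) or turns binary meets into joins (if $\varepsilon_f(i)=\partial$), every $g\in\mathcal G$ dually preserves binary meets or turns binary joins into meets, and the normal connectives do the same for empty joins and meets. **Canonical extensions.** A canonical extension of a bounded lattice $\mathbb A$ is a complete lattice $\mathbb A^\delta$ containing $\mathbb A$ as a bounded sublattice such that every element of $\mathbb A^\delta$ is a join of closed elements and a meet of open elements (closed, resp. open, elements are the meets, resp. joins, of subsets of $\mathbb A$), and such that $\bigwedge S\le\bigvee T$ with $S,T\subseteq\mathbb A$ implies $\bigwedge S'\le\bigvee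 T'$ for some finite $S'\subseteq S$, $T'\subseteq T$. If $\mathbb A$ is an $\mathcal L$-algebra, $\mathbb A^\delta$ carries the $\sigma$-extensions of the $f\in\mathcal F$ and the $\pi$-extensions of the $g\in\mathcal G$. An $\mathcal L$-inequality $\phi\le\psi$ is *canonical* if, for every $\mathcal L$-algebra $\mathbb A$ and every canonical extension $\mathbb A^\delta$ of it, $\mathbb A\models\phi\le\psi$ implies $\mathbb A^\delta\models\phi\le\psi$. **Extended language.** $\mathcal L^+$ has, in addition, nominals $\mathbf j$, co-nominals $\mathbf m$, symbols for the normalizations $\Diamond_f,\lhd_f,\Box_g,\rhd_g$ of the regular connectives, and symbols for the coordinatewise residuals (Galois-adjoints) $f^\sharp_i$, $g^\flat_i$ of the normal connectives and $\blacksquare_f,\blacktriangleleft_f,\Diamondblack_g,\blacktriangleright_g$ of the normalizations; $f^\sharp_i$ has order-type $\varepsilon_f(i)$ in coordinate $i$ and, for $j\ne i$, the opposite of $\varepsilon_f(j)$ if $\varepsilon_f(i)=1$ and $\varepsilon_f(j)$ itself if $\varepsilon_f(i)=\partial$; similarly for $g^\flat_i$. In a signed generation tree, signs are preserved by $\wedge,\vee$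 and by coordinates of order-type $1$ and reversed by coordinates of order-type $\partial$; the nodes $+f$ ($f\in\mathcal F$) and $-g$ ($g\in\mathcal G$) are called SAC. A formula is positive (negative) in $p$ if all occurrences of $p$ in its positive generation tree are signed $+$ (signed $-$). A formula, inequality or system is pure if it contains no propositional variable. **ALBA.** An execution on $\phi\le\psi$ runs as follows. 1. *Preprocessing.* Starting with $\{\phi\le\psi\}$, any finite sequence (in particular an exhaustive one) of the following steps: replace $\alpha(p)\le\beta(p)$ by $\alpha(\bot)\le\beta(\bot)$ if $\alpha$ is negative and $\beta$ positive in $p$, and by $\alpha(\top)\le\beta(\top)$ if $\alpha$ is positive and $\beta$ negative in $p$; in the trees $+\alpha$, $-\beta$ of an inequality $\alpha\le\beta$, distribute a node $+f$ over a child $+\vee$ or $-\wedge$, and a node $-g$ over a child $-\wedge$ or $+\vee$; split $\alpha\le\beta\wedge\gamma$ into $\alpha\le\beta$, $\alpha\le\gamma$, and $\alpha\vee\beta\le\gamma$ into $\alpha\le\gamma$, $\beta\le\gamma$. Each resulting inequality $\phi'\le\psi'$ gives an initial system $(S,\mathsf{Ineq})=(\varnothing,\phi'\le\psi')$. 2.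 *Reduction.* Each system is transformed by the following rules, in any order. * *Approximation:* if in the trees $+\phi$, $-\psi$ of $\mathsf{Ineq}=(\phi\le\psi)$ a subformula occurrence $\gamma\in\mathcal L$ is such that all nodes strictly above it are SAC, replace it by the first nominal $\mathbf j$ not occurring in the system and add $\mathbf j\le\gamma$ to $S$ if it is signed $+$; replace it by the first co-nominal $\mathbf m$ not occurring in the system and add $\gamma\le\mathbf m$ to $S$ if it is signed $-$. * *Splitting* in $S$, as above. * *Residuation* in $S$, for $f\in\mathcal F_n$ and $g\in\mathcal G_n$: replace $f(\phi_1,\dots,\phi_n)\le\psi$ by $\phi_i\le f^\sharp_i(\phi_1,\dots,\psi,\dots,\phi_n)$ if $\varepsilon_f(i)=1$ and by $f^\sharp_i(\phi_1,\dots,\psi,\dots,\phi_n)\le\phi_i$ if $\varepsilon_f(i)=\partial$; replace $\psi\le g(\phi_1,\dots,\phi_n)$ by $g^\flat_i(\phi_1,\dots,\psi,\dots,\phi_n)\le\phi_i$ if $\varepsilon_g(i)=1$ and by $\phi_i\le g^\flat_i(\phi_1,\dots,\psi,\dots,\phi_n)$ if $\varepsilon_g(i)=\partial$ (with $\psi$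 in the $i$th coordinate). * *Adjunction* in $S$, for $f\in\mathcal F_r$ and $g\in\mathcal G_r$: replace $f(\phi)\le\psi$ by $f(\bot)\le\psi$ and $\phi\le\blacksquare_f\psi$ if $\varepsilon_f=1$, and by $f(\top)\le\psi$ and $\blacktriangleleft_f\psi\le\phi$ if $\varepsilon_f=\partial$; replace $\phi\le g(\psi)$ by $\phi\le g(\top)$ and $\Diamondblack_g\phi\le\psi$ if $\varepsilon_g=1$, and by $\phi\le g(\bot)$ and $\psi\le\blacktriangleright_g\phi$ if $\varepsilon_g=\partial$. The first inequality of each pair is a *side condition*. * *Ackermann rules:* if $S=\{\alpha_i\le p\mid i\le n\}\cup\{\beta_j\le\gamma_j\mid j\in J\}$, $p$ does not occur in the $\alpha_i$ or in $\mathsf{Ineq}$, and all $\beta_j$ are positive and all $\gamma_j$ negative in $p$, replace $S$ by $\{\beta_j(\bigvee_i\alpha_i/p)\le\gamma_j(\bigvee_i\alpha_i/p)\mid j\in J\}$; if $S=\{p\le\alpha_i\mid i\le n\}\cup\{\beta_j\le\gamma_j\mid j\in J\}$, $p$ does not occur in the $\alpha_i$ or in $\mathsf{Ineq}$, and all $\beta_j$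 are negative and all $\gamma_j$ positive in $p$, replace $S$ by $\{\beta_j(\bigwedge_i\alpha_i/p)\le\gamma_j(\bigwedge_i\alpha_i/p)\mid j\in J\}$. Here $n=0$ is allowed, with $\bigvee\varnothing=\bot$ and $\bigwedge\varnothing=\top$. 3. ALBA *succeeds* through the execution if every initial system is transformed into a pure system. The execution is *pivotal* if every approximation step is applied to an occurrence $\gamma$ whose root is not itself an SAC node (the SAC branch is maximal), and *safe* if no side condition introduced by an adjunction step is rewritten later by a splitting, residuation or adjunction step (only Ackermann rules may act on it). **Theorem.** Every $\mathcal L_{\mathrm{LE}}$-inequality $\phi\le\psi$ on which ALBA succeeds through some safe and pivotal execution is canonical. -/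

import Mathlib

universe w u v

namespace ALBA

/-! ## Signs, order-types and LE-languages -/

/-- Signs. As the entry of an order-type, `pos` is `1` and `neg` is `∂`; as the label of a node of
a signed generation tree, `pos` is `+` and `neg` is `-`; as the family of a connective, `pos` is
the family `F` and `neg` is the family `G`. -/
inductive Pol : Type
  | pos
  | neg

/-- The opposite sign. -/
def Pol.flip : Pol → Pol
  | .pos => .neg
  | .neg => .pos

/-- Product of signs: `s.mul ε` is the sign of the `i`-th child of a node signed `s` whose
connective has order-type `ε` in the `i`-th coordinate. -/
def Pol.mul : Pol → Pol → Pol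
  | .pos, t => t
  | .neg, t => t.flip

/-- An LE-language `L(F, G)`: the connectives are split into the families `F` (`fam c = pos`) and
`G` (`fam c = neg`), and each family into its regular connectives (`reg c`: `F_r`, `G_r`; these are
unary) and its normal connectives (`¬ reg c`: `F_n`, `G_n`). Every connective has a finite arity
(possibly `0`) and an order-type. -/
structure Sig : Type (w + 1) where
  Conn : Type w
  fam : Conn → Pol
  reg : Conn → Prop
  ar : Conn → ℕ
  eps : (c : Conn) → Fin (ar c) → Pol
  ar_reg : ∀ c, reg c → ar c = 1

/-- Terms over the connectives of `L` with variables in `V`. -/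
inductive Term (L : Sig.{w}) (V : Type) : Type w
  | var (x : V) : Term L V
  | bot : Term L V
  | top : Term L V
  | inf (a b : Term L V) : Term L V
  | sup (a b : Term L V) : Term L V
  | app (c : L.Conn) (args : Fin (L.ar c) → Term L V) : Term L V

/-- Inequalities `lhs ≤ rhs` between terms. -/
structure Ineq (L : Sig.{w}) (V : Type) : Type w where
  lhs : Term L V
  rhs : Term L V

/-- Formulas of the language `L`, with the propositional variables `p₀, p₁, …`. -/
abbrev Form (L : Sig.{w}) : Type w := Term L ℕ

section Terms

variable {L : Sig.{w}} {V W : Type}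

/-- `t.Occ s x`: some occurrence of the variable `x` has the sign `s` in the positive generation
tree `+t`. -/
def Term.Occ : Term L V → Pol → V → Prop
  | .var y, s, x => s = Pol.pos ∧ y = x
  | .bot, _, _ => False
  | .top, _, _ => False
  | .inf a b, s, x => a.Occ s x ∨ b.Occ s x
  | .sup a b, s, x => a.Occ s x ∨ b.Occ s x
  | .app c args, s, x => ∃ i, (args i).Occ ((L.eps c i).mul s) x

/-- The variable `x` occurs in `t`. -/
def Term.Occurs (t : Term L V) (x : V) : Prop := ∃ s, t.Occ s x

/-- `t` is positive in `x`: all occurrences of `x` in `+t` are positive. -/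
def Term.PosIn (t : Term L V) (x : V) : Prop := ¬ t.Occ Pol.neg x

/-- `t` is negative in `x`: all occurrences of `x` in `+t` are negative. -/
def Term.NegIn (t : Term L V) (x : V) : Prop := ¬ t.Occ Pol.pos x

/-- The variable `x` occurs in the inequality. -/
def Ineq.Occurs (q : Ineq L V) (x : V) : Prop := q.lhs.Occurs x ∨ q.rhs.Occurs x

/-- `t.subst σ`: simultaneous substitution of `σ x` for every variable `x`. -/
def Term.subst (σ : V → Term L W) : Term L V → Term L W
  | .var x => σ x
  | .bot => .bot
  | .top => .top
  | .inf a b => .inf (a.subst σ) (b.subst σ)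
  | .sup a b => .sup (a.subst σ) (b.subst σ)
  | .app c args => .app c fun i => (args i).subst σ

/-- `t.subst1 x a` is `t(a / x)`. -/
def Term.subst1 [DecidableEq V] (t : Term L V) (x : V) (a : Term L V) : Term L V :=
  t.subst (Function.update Term.var x a)

/-- Substitution of `a` for `x` on both sides of an inequality. -/
def Ineq.subst1 [DecidableEq V] (q : Ineq L V) (x : V) (a : Term L V) : Ineq L V :=
  ⟨q.lhs.subst1 x a, q.rhs.subst1 x a⟩

/-- `Ineq.of pos a b` is `a ≤ b`, and `Ineq.of neg a b` is `b ≤ a`. -/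
def Ineq.of : Pol → Term L V → Term L V → Ineq L V
  | .pos, a, b => ⟨a, b⟩
  | .neg, a, b => ⟨b, a⟩

/-- `Term.join pos a b` is `a ∨ b`, and `Term.join neg a b` is `a ∧ b`. -/
def Term.join : Pol → Term L V → Term L V → Term L V
  | .pos, a, b => .sup a b
  | .neg, a, b => .inf a b

/-- `Term.zero pos` is `⊥`, and `Term.zero neg` is `⊤`. -/
def Term.zero : Pol → Term L V
  | .pos => .bot
  | .neg => .top

/-- The disjunction (`s = pos`) or conjunction (`s = neg`) of a finite list of terms. The empty
disjunction is `⊥` and the empty conjunction is `⊤`. -/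
def Term.bigJoin (s : Pol) : List (Term L V) → Term L V
  | [] => Term.zero s
  | [a] => a
  | a :: b :: l => Term.join s a (Term.bigJoin s (b :: l))

/-- The value of a term in an algebra with operations `op`, under the assignment `v`. -/
def Term.eval {A : Type u} [Lattice A] [BoundedOrder A]
    (op : (c : L.Conn) → (Fin (L.ar c) → A) → A) (v : V → A) : Term L V → A
  | .var x => v x
  | .bot => ⊥
  | .top => ⊤
  | .inf a b => a.eval op v ⊓ b.eval op v
  | .sup a b => a.eval op v ⊔ b.eval op v
  | .app c args => op c fun i => (args i).eval op v

/-- The inequality is valid in the algebra with operations `op`: it holds under all assignments. -/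
def Ineq.Valid {A : Type u} [Lattice A] [BoundedOrder A]
    (op : (c : L.Conn) → (Fin (L.ar c) → A) → A) (q : Ineq L V) : Prop :=
  ∀ v : V → A, q.lhs.eval op v ≤ q.rhs.eval op v

end Terms

/-! ## Lattice expansions and their canonical extensions -/

/-- `pjoin pos a b = a ⊔ b` and `pjoin neg a b = a ⊓ b`. -/
def pjoin {A : Type u} [Lattice A] : Pol → A → A → A
  | .pos, a, b => a ⊔ b
  | .neg, a, b => a ⊓ b

/-- `pzero pos = ⊥` and `pzero neg = ⊤`. -/
def pzero {A : Type u} [Lattice A] [BoundedOrder A] : Pol → A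
  | .pos => ⊥
  | .neg => ⊤

/-- The relation `≤` (for `pos`) or `≥` (for `neg`). -/
def ple {A : Type u} [LE A] : Pol → A → A → Prop
  | .pos, a, b => a ≤ b
  | .neg, a, b => b ≤ a

/-- An `L`-algebra (lattice expansion) on the bounded lattice `A`. Each `f` in the family `F`, in
each coordinate, preserves binary joins if its order-type is `1` there and turns binary meets into
joins if its order-type is `∂` there; each `g` in `G` preserves binary meets, resp. turns binary
joins into meets. Normal connectives do the same with the empty joins and meets. -/
structure LEAlgebra (L : Sig.{w}) (A : Type u) [Lattice A] [BoundedOrder A] where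
  op : (c : L.Conn) → (Fin (L.ar c) → A) → A
  op_join : ∀ (c : L.Conn) (i : Fin (L.ar c)) (x : Fin (L.ar c) → A) (a b : A),
    op c (Function.update x i (pjoin ((L.fam c).mul (L.eps c i)) a b)) =
      pjoin (L.fam c) (op c (Function.update x i a)) (op c (Function.update x i b))
  op_zero : ∀ (c : L.Conn), ¬ L.reg c → ∀ (i : Fin (L.ar c)) (x : Fin (L.ar c) → A),
    op c (Function.update x i (pzero ((L.fam c).mul (L.eps c i)))) = pzero (L.fam c)

section CanonicalExtension

variable {A : Type u} {C : Type v} [Lattice A] [BoundedOrder A] [CompleteLattice C]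

/-- Closed elements: meets of elements of `A`. -/
def ClosedElt (e : A → C) (x : C) : Prop := ∃ S : Set A, x = sInf (e '' S)

/-- Open elements: joins of elements of `A`. -/
def OpenElt (e : A → C) (x : C) : Prop := ∃ S : Set A, x = sSup (e '' S)

/-- `e` exhibits the complete lattice `C` as a canonical extension of the bounded lattice `A`:
a dense and compact completion. -/
structure IsCanonicalExtension (e : BoundedLatticeHom A C) : Prop where
  injective : Function.Injective e
  join_dense : ∀ x : C, ∃ K : Set C, (∀ k ∈ K, ClosedElt e k) ∧ x = sSup K
  meet_dense : ∀ x : C, ∃ O : Set C, (∀ o ∈ O, OpenElt e o) ∧ x = sInf O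
  compact : ∀ S T : Set A, sInf (e '' S) ≤ sSup (e '' T) →
    ∃ S' T' : Finset A, ↑S' ⊆ S ∧ ↑T' ⊆ T ∧ S'.inf id ≤ T'.sup id

/-- Membership in `K(C)` (for `pos`) or `O(C)` (for `neg`), i.e. closed elements of the lattice
or of its dual. -/
def PClosed (e : A → C) : Pol → C → Prop
  | .pos, x => ClosedElt e x
  | .neg, x => OpenElt e x

/-- The `σ`-extension of an `n`-ary `ε`-monotone operation. -/
def sigmaExt (e : A → C) {n : ℕ} (ε : Fin n → Pol) (f : (Fin n → A) → A) (x : Fin n → C) : C :=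
  sSup {y | ∃ k : Fin n → C, (∀ i, PClosed e (ε i) (k i)) ∧ (∀ i, ple (ε i) (k i) (x i)) ∧
    y = sInf {z | ∃ a : Fin n → A, (∀ i, ple (ε i) (k i) (e (a i))) ∧ z = e (f a)}}

/-- The `π`-extension of an `n`-ary `ε`-monotone operation. -/
def piExt (e : A → C) {n : ℕ} (ε : Fin n → Pol) (g : (Fin n → A) → A) (x : Fin n → C) : C :=
  sInf {y | ∃ o : Fin n → C, (∀ i, PClosed e (ε i).flip (o i)) ∧ (∀ i, ple (ε i) (x i) (o i)) ∧
    y = sSup {z | ∃ a : Fin n → A, (∀ i, ple (ε i) (e (a i)) (o i)) ∧ z = e (g a)}}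

/-- The operations of the canonical extension of an `L`-algebra: `σ`-extensions for connectives
in `F`, `π`-extensions for connectives in `G`. -/
def LEAlgebra.canOp {L : Sig.{w}} (𝔸 : LEAlgebra L A) (e : A → C) (c : L.Conn) :
    (Fin (L.ar c) → C) → C :=
  match L.fam c with
  | .pos => sigmaExt e (L.eps c) (𝔸.op c)
  | .neg => piExt e (L.eps c) (𝔸.op c)

end CanonicalExtension

/-- An `L`-inequality is canonical if its validity in an `L`-algebra implies its validity in the
canonical extension of that algebra. -/
def Canonical {L : Sig.{w}} (q : Ineq L ℕ) : Prop :=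
  ∀ (A : Type u) [Lattice A] [BoundedOrder A] (𝔸 : LEAlgebra L A)
    (C : Type v) [CompleteLattice C] (e : BoundedLatticeHom A C),
    IsCanonicalExtension e → q.Valid 𝔸.op → q.Valid (𝔸.canOp (C := C) e)

/-! ## The languages `L*` and `L⁺` -/

/-- The connectives of the tense language `L*`. -/
inductive StarConn (L : Sig.{w}) : Type w
  /-- the connectives of `L` -/
  | base (c : L.Conn) : StarConn L
  /-- the normalization of a regular connective: `◇_f`, `◁_f`, `□_g`, `▷_g` -/
  | norm (c : L.Conn) (h : L.reg c) : StarConn L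
  /-- the `i`-th residual (or Galois-adjoint) `f♯ᵢ`, `g♭ᵢ` of a normal connective `c`, and that of
  the normalization of `c`, written `■_f`, `◂_f`, `◆_g`, `▸_g`, if `c` is regular -/
  | res (c : L.Conn) (i : Fin (L.ar c)) : StarConn L

/-- The tense language `L*` as an LE-language. The residual of `f ∈ F` in coordinate `i` lies in
`G*` if `ε_f(i) = 1` and in `F*` if `ε_f(i) = ∂`; dually for `g ∈ G`. Its order-type agrees with
that of the original connective in coordinate `i`; the others are reversed if `ε(i) = 1` and kept
if `ε(i) = ∂`. -/
def Sig.star (L : Sig.{w}) : Sig.{w} where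
  Conn := StarConn L
  fam
    | .base c => L.fam c
    | .norm c _ => L.fam c
    | .res c i => ((L.fam c).mul (L.eps c i)).flip
  reg
    | .base c => L.reg c
    | .norm _ _ => False
    | .res _ _ => False
  ar
    | .base c => L.ar c
    | .norm c _ => L.ar c
    | .res c _ => L.ar c
  eps
    | .base c => L.eps c
    | .norm c _ => L.eps c
    | .res c i => fun j =>
        if j = i then L.eps c i
        else match L.eps c i with
          | .pos => (L.eps c j).flip
          | .neg => L.eps c j
  ar_reg
    | .base c, h => L.ar_reg c h
    | .norm _ _, h => h.elim
    | .res _ _, h => h.elim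

/-- The variables of `L⁺`: propositional variables, nominals and co-nominals. -/
inductive PVar : Type
  | prop (n : ℕ)
  | nom (n : ℕ)
  | conom (n : ℕ)
  deriving DecidableEq

/-- The formulas of `L⁺`. -/
abbrev FormP (L : Sig.{w}) : Type w := Term L.star PVar

/-- The inequalities of `L⁺`. -/
abbrev IneqP (L : Sig.{w}) : Type w := Ineq L.star PVar

/-- The inclusion of `L` in `L⁺`. -/
def Term.emb {L : Sig.{w}} : Form L → FormP L
  | .var n => .var (.prop n)
  | .bot => .bot
  | .top => .top
  | .inf a b => .inf a.emb b.emb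
  | .sup a b => .sup a.emb b.emb
  | .app c args => .app (L := L.star) (StarConn.base c) fun i => (args i).emb

section Algorithm

variable {L : Sig.{w}}

/-- The `L⁺`-formula `c(φ₁, …, φₙ)` for a connective `c` of `L`. -/
def appBase (c : L.Conn) (φ : Fin (L.ar c) → FormP L) : FormP L :=
  .app (L := L.star) (StarConn.base c) φ

/-- The `L⁺`-formula whose outermost connective is the residual in coordinate `i` of `c` (or of
the normalization of `c` if `c` is regular). -/
def appRes (c : L.Conn) (i : Fin (L.ar c)) (φ : Fin (L.ar c) → FormP L) : FormP L :=
  .app (L := L.star) (StarConn.res c i) φ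

/-! ## Stage 1: preprocessing -/

/-- `Distr s t t'`: `t'` is obtained from `t` by one distribution step inside the generation tree
of `t` whose root is signed `s`. At a node signed `+`, a connective `f ∈ F` distributes over a
child `+∨` or `-∧`, and at a node signed `-`, a connective `g ∈ G` distributes over a child `-∧`
or `+∨`. -/
inductive Distr : Pol → Form L → Form L → Prop
  | root (s : Pol) (c : L.Conn) (hc : L.fam c = s) (φ : Fin (L.ar c) → Form L)
      (i : Fin (L.ar c)) (a b : Form L) (hφ : φ i = Term.join (s.mul (L.eps c i)) a b) :
      Distr s (.app c φ)
        (Term.join s (.app c (Function.update φ i a)) (.app c (Function.update φ i b)))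
  | inf_left (s : Pol) (a a' b : Form L) : Distr s a a' → Distr s (.inf a b) (.inf a' b)
  | inf_right (s : Pol) (a b b' : Form L) : Distr s b b' → Distr s (.inf a b) (.inf a b')
  | sup_left (s : Pol) (a a' b : Form L) : Distr s a a' → Distr s (.sup a b) (.sup a' b)
  | sup_right (s : Pol) (a b b' : Form L) : Distr s b b' → Distr s (.sup a b) (.sup a b')
  | arg (s : Pol) (c : L.Conn) (φ : Fin (L.ar c) → Form L) (i : Fin (L.ar c)) (a : Form L) :
      Distr (s.mul (L.eps c i)) (φ i) a → Distr s (.app c φ) (.app c (Function.update φ i a))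

/-- `Preprocess q Q`: preprocessing may turn the inequality `q` into the finite collection `Q`.
The rules (elimination of uniform variables, distribution, splitting) may be applied in any order
and any number of times, hence in particular exhaustively. -/
inductive Preprocess : Ineq L ℕ → List (Ineq L ℕ) → Prop
  | done (q : Ineq L ℕ) : Preprocess q [q]
  | elim_bot (α β : Form L) (p : ℕ) (Q : List (Ineq L ℕ)) (hα : α.NegIn p) (hβ : β.PosIn p) :
      Preprocess ⟨α.subst1 p .bot, β.subst1 p .bot⟩ Q → Preprocess ⟨α, β⟩ Q
  | elim_top (α β : Form L) (p : ℕ) (Q : List (Ineq L ℕ)) (hα : α.PosIn p) (hβ : β.NegIn p) :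
      Preprocess ⟨α.subst1 p .top, β.subst1 p .top⟩ Q → Preprocess ⟨α, β⟩ Q
  | distr_left (α α' β : Form L) (Q : List (Ineq L ℕ)) (h : Distr Pol.pos α α') :
      Preprocess ⟨α', β⟩ Q → Preprocess ⟨α, β⟩ Q
  | distr_right (α β β' : Form L) (Q : List (Ineq L ℕ)) (h : Distr Pol.neg β β') :
      Preprocess ⟨α, β'⟩ Q → Preprocess ⟨α, β⟩ Q
  | split_inf (α β γ : Form L) (Q Q' : List (Ineq L ℕ)) :
      Preprocess ⟨α, β⟩ Q → Preprocess ⟨α, γ⟩ Q' → Preprocess ⟨α, .inf β γ⟩ (Q ++ Q')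
  | split_sup (α β γ : Form L) (Q Q' : List (Ineq L ℕ)) :
      Preprocess ⟨α, γ⟩ Q → Preprocess ⟨β, γ⟩ Q' → Preprocess ⟨.sup α β, γ⟩ (Q ++ Q')

/-! ## Stage 2: reduction and elimination -/

/-- A system `(S, Ineq)`, together with the record `side` of those inequalities in `S` that were
introduced as side conditions by the adjunction rules for regular connectives. -/
structure System (L : Sig.{w}) : Type w where
  S : Set (IneqP L)
  side : Set (IneqP L)
  goal : IneqP L

/-- The initial system of an `L`-inequality. -/
def System.init (q : Ineq L ℕ) : System L := ⟨∅, ∅, ⟨q.lhs.emb, q.rhs.emb⟩⟩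

/-- The variable `x` occurs in the system. -/
def System.Occurs (T : System L) (x : PVar) : Prop := T.goal.Occurs x ∨ ∃ q ∈ T.S, q.Occurs x

/-- The system is pure: it contains no propositional variable. -/
def System.Pure (T : System L) : Prop := ∀ p : ℕ, ¬ T.Occurs (.prop p)

/-- `SACNode s t`: the root of the generation tree of `t`, when signed `s`, is an SAC node, i.e.
`+f` with `f ∈ F` or `-g` with `g ∈ G`. -/
def SACNode (s : Pol) (t : FormP L) : Prop :=
  ∃ (c : L.Conn) (φ : Fin (L.ar c) → FormP L), t = appBase c φ ∧ L.fam c = s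

/-- `SACContext s s' Φ`: the one-hole context `Φ = φ'(!x)` is such that, in its generation tree
with root signed `s`, the hole `x` is signed `s'` and all nodes on the branch from the root to the
hole (the hole excluded) are SAC nodes. -/
inductive SACContext : Pol → Pol → (FormP L → FormP L) → Prop
  | hole (s : Pol) : SACContext s s fun x => x
  | node (s s' : Pol) (c : L.Conn) (hc : L.fam c = s) (φ : Fin (L.ar c) → FormP L)
      (i : Fin (L.ar c)) (Φ : FormP L → FormP L) (h : SACContext (s.mul (L.eps c i)) s' Φ) :
      SACContext s s' fun x => appBase c (Function.update φ i (Φ x))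

/-- The `n`-th nominal (for `pos`) or the `n`-th co-nominal (for `neg`). -/
def special : Pol → ℕ → PVar
  | .pos, n => .nom n
  | .neg, n => .conom n

/-- One application of a reduction rule. If `piv` holds, approximation rules are applied only
pivotally, i.e. at nodes whose SAC branch is maximal. If `safe` holds, side conditions are not
modified except by Ackermann rules. Thus `Step False False` describes arbitrary executions and
`Step True True` safe and pivotal ones. -/
inductive Step (piv safe : Prop) : System L → System L → Prop
  /-- The approximation rules: `(S, φ'(γ) ≤ ψ)` (for `s = pos`) or `(S, ψ ≤ φ'(γ))` (for
  `s = neg`), with the branch to `γ` SAC and `γ` in the original language, becomes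
  `(S ∪ {j ≤ γ}, …φ'(j)…)` if `γ` is signed `+` and `(S ∪ {γ ≤ m}, …φ'(m)…)` if it is signed `-`;
  the nominal `j` (the co-nominal `m`) is the first one not occurring in the system. -/
  | approx (S D : Set (IneqP L)) (s s' : Pol) (Φ : FormP L → FormP L) (γ : Form L) (ψ : FormP L)
      (n : ℕ) (hΦ : SACContext s s' Φ) (hpiv : piv → ¬ SACNode s' γ.emb)
      (hn : IsLeast {k | ¬ System.Occurs ⟨S, D, Ineq.of s (Φ γ.emb) ψ⟩ (special s' k)} n) :
      Step piv safe ⟨S, D, Ineq.of s (Φ γ.emb) ψ⟩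
        ⟨insert (Ineq.of s' (.var (special s' n)) γ.emb) S, D,
          Ineq.of s (Φ (.var (special s' n))) ψ⟩
  /-- Residuation for normal connectives. For `f ∈ F_n`, `f(φ₁, …, φₙ) ≤ ψ` is replaced by
  `φᵢ ≤ f♯ᵢ(φ₁, …, ψ, …, φₙ)` if `ε_f(i) = 1`, and by `f♯ᵢ(φ₁, …, ψ, …, φₙ) ≤ φᵢ` if
  `ε_f(i) = ∂`; for `g ∈ G_n`, `ψ ≤ g(φ₁, …, φₙ)` is replaced by `g♭ᵢ(φ₁, …, ψ, …, φₙ) ≤ φᵢ` if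
  `ε_g(i) = 1`, and by `φᵢ ≤ g♭ᵢ(φ₁, …, ψ, …, φₙ)` if `ε_g(i) = ∂`. -/
  | residuation (S D : Set (IneqP L)) (I : IneqP L) (c : L.Conn) (hc : ¬ L.reg c)
      (φ : Fin (L.ar c) → FormP L) (ψ : FormP L) (i : Fin (L.ar c)) (q : IneqP L)
      (hq : q = Ineq.of (L.fam c) (appBase c φ) ψ) (hS : q ∈ S) (hsafe : safe → q ∉ D) :
      Step piv safe ⟨S, D, I⟩
        ⟨insert (Ineq.of ((L.fam c).mul (L.eps c i)) (φ i)
            (appRes c i (Function.update φ i ψ))) (S \ {q}), D \ {q}, I⟩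
  /-- Adjunction for regular (unary) connectives, introducing a side condition. For `f ∈ F_r`,
  `f(φ) ≤ ψ` is replaced by `f(⊥) ≤ ψ` and `φ ≤ ■_f ψ` if `ε_f = 1`, and by `f(⊤) ≤ ψ` and
  `◂_f ψ ≤ φ` if `ε_f = ∂`; for `g ∈ G_r`, `ψ ≤ g(φ)` is replaced by `ψ ≤ g(⊤)` and `◆_g ψ ≤ φ` if
  `ε_g = 1`, and by `ψ ≤ g(⊥)` and `φ ≤ ▸_g ψ` if `ε_g = ∂`. -/
  | adjunction (S D : Set (IneqP L)) (I : IneqP L) (c : L.Conn) (hc : L.reg c)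
      (φ : Fin (L.ar c) → FormP L) (ψ : FormP L) (i : Fin (L.ar c)) (q r : IneqP L)
      (hq : q = Ineq.of (L.fam c) (appBase c φ) ψ) (hS : q ∈ S) (hsafe : safe → q ∉ D)
      (hr : r = Ineq.of (L.fam c)
        (appBase c fun _ => Term.zero ((L.fam c).mul (L.eps c i))) ψ) :
      Step piv safe ⟨S, D, I⟩
        ⟨insert r (insert (Ineq.of ((L.fam c).mul (L.eps c i)) (φ i)
            (appRes c i fun _ => ψ)) (S \ {q})), insert r (D \ {q}), I⟩
  | split_inf (S D : Set (IneqP L)) (I : IneqP L) (α β γ : FormP L) (q : IneqP L)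
      (hq : q = ⟨α, .inf β γ⟩) (hS : q ∈ S) (hsafe : safe → q ∉ D) :
      Step piv safe ⟨S, D, I⟩ ⟨insert ⟨α, β⟩ (insert ⟨α, γ⟩ (S \ {q})), D \ {q}, I⟩
  | split_sup (S D : Set (IneqP L)) (I : IneqP L) (α β γ : FormP L) (q : IneqP L)
      (hq : q = ⟨.sup α β, γ⟩) (hS : q ∈ S) (hsafe : safe → q ∉ D) :
      Step piv safe ⟨S, D, I⟩ ⟨insert ⟨α, γ⟩ (insert ⟨β, γ⟩ (S \ {q})), D \ {q}, I⟩
  /-- The right Ackermann rule: `S = {αᵢ ≤ p} ∪ {βⱼ(p) ≤ γⱼ(p)}` is replaced by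
  `{βⱼ(⋁ αᵢ) ≤ γⱼ(⋁ αᵢ)}`. -/
  | ackermann_right (S D R : Set (IneqP L)) (I : IneqP L) (p : ℕ) (αs : List (FormP L))
      (hS : S = {q | ∃ α ∈ αs, q = ⟨α, .var (.prop p)⟩} ∪ R)
      (hα : ∀ α ∈ αs, ¬ α.Occurs (.prop p)) (hI : ¬ I.Occurs (.prop p))
      (hβ : ∀ q ∈ R, q.lhs.PosIn (.prop p)) (hγ : ∀ q ∈ R, q.rhs.NegIn (.prop p)) :
      Step piv safe ⟨S, D, I⟩
        ⟨(fun q => q.subst1 (.prop p) (Term.bigJoin .pos αs)) '' R,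
          (fun q => q.subst1 (.prop p) (Term.bigJoin .pos αs)) '' (D ∩ R), I⟩
  /-- The left Ackermann rule: `S = {p ≤ αᵢ} ∪ {βⱼ(p) ≤ γⱼ(p)}` is replaced by
  `{βⱼ(⋀ αᵢ) ≤ γⱼ(⋀ αᵢ)}`. -/
  | ackermann_left (S D R : Set (IneqP L)) (I : IneqP L) (p : ℕ) (αs : List (FormP L))
      (hS : S = {q | ∃ α ∈ αs, q = ⟨.var (.prop p), α⟩} ∪ R)
      (hα : ∀ α ∈ αs, ¬ α.Occurs (.prop p)) (hI : ¬ I.Occurs (.prop p))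
      (hβ : ∀ q ∈ R, q.lhs.NegIn (.prop p)) (hγ : ∀ q ∈ R, q.rhs.PosIn (.prop p)) :
      Step piv safe ⟨S, D, I⟩
        ⟨(fun q => q.subst1 (.prop p) (Term.bigJoin .neg αs)) '' R,
          (fun q => q.subst1 (.prop p) (Term.bigJoin .neg αs)) '' (D ∩ R), I⟩

/-! ## Stage 3: success -/

/-- ALBA succeeds on the inequality `q` through some execution that is pivotal if `piv` holds and
safe if `safe` holds: after some preprocessing of `q`, every initial system can be reduced to a
pure system. -/
def Succeeds (piv safe : Prop) (q : Ineq L ℕ) : Prop :=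
  ∃ Q : List (Ineq L ℕ), Preprocess q Q ∧
    ∀ r ∈ Q, ∃ T : System L, Relation.ReflTransGen (Step piv safe) (System.init r) T ∧ T.Pure

end Algorithm

end ALBA

namespace ALBA

/-! ## Signs and polarized orders -/

/-! The argument is U-shaped and takes place in $\mathbb A^\delta$. Validity in $\mathbb A$ is read
there as truth under admissible assignments, which send propositional variables into $\mathbb A$,
nominals to closed and co-nominals to open elements. The rules carry this truth down to the pure
system. A pure system cannot see the values of propositional variables, so it is then true under
every `Special` assignment, and the rules carry that truth back up to the initial system, whose
propositional variables are now arbitrary in $\mathbb A^\delta$.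

The approximation rules rest on two facts: every element is the join of the closed elements below
it, a set containing $\bot$, and an SAC context preserves nonempty joins (`pExt_update_pSup_ple`,
`SACContext.exists_eval_eq`). No join-irreducible elements are needed. Nonempty joins are also all
that regular connectives preserve; the side condition of an adjunction step says exactly that the
set whose join is the residual is nonempty (`canOp_ple_iff`).

The delicate point is the Ackermann rule on the way down, since the value $\bigvee_i\alpha_i$ that
it eliminates need not lie in $\mathbb A$. Every inequality of a reachable $S$ has a syntactically
closed left side and a syntactically open right side (`Step.regular`), so $\bigvee_i\alpha_i$ is
closed, and compactness replaces it by an element of $\mathbb A$ above it without destroying the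
finitely many remaining inequalities (`Term.Clo.approximates`, `exists_sat_of_sat_update`). On the
way up monotonicity alone suffices (`System.Holds.of_ackermann`).

Order duality is built into the notation: `ple s`, `pjoin s`, `PClosed e s` denote a notion for `s =
pos` and its order dual for `s = neg`, so one proof serves $\mathcal F$ and $\mathcal G$, closed and
open, both order-types and both Ackermann rules. -/

@[simp] theorem Pol.flip_flip (s : Pol) : s.flip.flip = s := by cases s <;> rfl

@[simp] theorem Pol.pos_mul (s : Pol) : Pol.pos.mul s = s := rfl

@[simp] theorem Pol.neg_mul (s : Pol) : Pol.neg.mul s = s.flip := rfl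

@[simp] theorem Pol.mul_pos (s : Pol) : s.mul .pos = s := by cases s <;> rfl

@[simp] theorem Pol.mul_mul_cancel (s t : Pol) : s.mul (s.mul t) = t := by
  cases s <;> cases t <;> rfl

theorem Pol.mul_assoc (s t r : Pol) : (s.mul t).mul r = s.mul (t.mul r) := by
  cases s <;> cases t <;> cases r <;> rfl

theorem Pol.eq_of_ne_flip {s t : Pol} (h : s ≠ t.flip) : s = t := by
  cases s <;> cases t <;> first | rfl | exact absurd rfl h

section Order

variable {A : Type u}

@[simp] theorem ple_flip [LE A] (s : Pol) (a b : A) : ple s.flip a b ↔ ple s b a := by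
  cases s <;> rfl

theorem ple_refl [Preorder A] (s : Pol) (a : A) : ple s a a := by
  cases s <;> exact le_refl a

theorem ple_trans [Preorder A] {s : Pol} {a b c : A} (h : ple s a b) (h' : ple s b c) :
    ple s a c := by
  cases s
  · exact le_trans h h'
  · exact le_trans h' h

theorem ple_antisymm [PartialOrder A] {s : Pol} {a b : A} (h : ple s a b) (h' : ple s b a) :
    a = b := by
  cases s
  · exact le_antisymm h h'
  · exact le_antisymm h' h

theorem pjoin_ple [Lattice A] {s : Pol} {a b c : A} :
    ple s (pjoin s a b) c ↔ ple s a c ∧ ple s b c := by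
  cases s
  · exact sup_le_iff
  · exact le_inf_iff

theorem ple_pmeet [Lattice A] {s : Pol} {a b c : A} :
    ple s c (pjoin s.flip a b) ↔ ple s c a ∧ ple s c b := by
  cases s
  · exact le_inf_iff
  · exact sup_le_iff

theorem ple_pjoin_left [Lattice A] (s : Pol) (a b : A) : ple s a (pjoin s a b) :=
  (pjoin_ple.1 (ple_refl s _)).1

theorem ple_pjoin_right [Lattice A] (s : Pol) (a b : A) : ple s b (pjoin s a b) :=
  (pjoin_ple.1 (ple_refl s _)).2

theorem pmeet_ple_left [Lattice A] (s : Pol) (a b : A) : ple s (pjoin s.flip a b) a :=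
  (ple_pmeet.1 (ple_refl s _)).1

theorem pmeet_ple_right [Lattice A] (s : Pol) (a b : A) : ple s (pjoin s.flip a b) b :=
  (ple_pmeet.1 (ple_refl s _)).2

theorem pjoin_eq_right [Lattice A] {s : Pol} {a b : A} (h : ple s a b) : pjoin s a b = b :=
  ple_antisymm (pjoin_ple.2 ⟨h, ple_refl s b⟩) (ple_pjoin_right s a b)

theorem pzero_ple [Lattice A] [BoundedOrder A] (s : Pol) (a : A) : ple s (pzero s) a := by
  cases s
  · exact bot_le
  · exact le_top

theorem ple_pone [Lattice A] [BoundedOrder A] (s : Pol) (a : A) : ple s a (pzero s.flip) := by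
  cases s
  · exact le_top
  · exact bot_le

/-- The join (for `pos`) or meet (for `neg`) of a set. -/
def pSup [CompleteLattice A] : Pol → Set A → A
  | .pos, X => sSup X
  | .neg, X => sInf X

theorem ple_pSup [CompleteLattice A] {s : Pol} {X : Set A} {a : A} (h : a ∈ X) :
    ple s a (pSup s X) := by
  cases s
  · exact le_sSup h
  · exact sInf_le h

theorem pSup_ple [CompleteLattice A] {s : Pol} {X : Set A} {a : A} (h : ∀ x ∈ X, ple s x a) :
    ple s (pSup s X) a := by
  cases s
  · exact sSup_le h
  · exact le_sInf h

theorem pInf_ple [CompleteLattice A] {s : Pol} {X : Set A} {a : A} (h : a ∈ X) :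
    ple s (pSup s.flip X) a :=
  (ple_flip s _ _).1 (ple_pSup h)

theorem ple_pInf [CompleteLattice A] {s : Pol} {X : Set A} {a : A} (h : ∀ x ∈ X, ple s a x) :
    ple s a (pSup s.flip X) :=
  (ple_flip s _ _).1 (pSup_ple fun x hx => (ple_flip s _ _).2 (h x hx))

/-- A function that is monotone in each coordinate is monotone. -/
theorem monotone_of_coordinatewise {n : ℕ} {X Y : Type*} {F : (Fin n → X) → Y}
    {R : Fin n → X → X → Prop} {Q : Y → Y → Prop} (hrefl : ∀ y, Q y y)
    (htrans : ∀ x y z, Q x y → Q y z → Q x z)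
    (h : ∀ x i y, R i (x i) y → Q (F x) (F (Function.update x i y)))
    {x y : Fin n → X} (hxy : ∀ i, R i (x i) (y i)) : Q (F x) (F y) := by
  classical
  -- The coordinates are changed one at a time.
  have key : ∀ S : Finset (Fin n), Q (F x) (F fun i => if i ∈ S then y i else x i) := by
    intro S
    induction S using Finset.induction_on with
    | empty => simpa using hrefl (F x)
    | insert i S hi ih =>
      refine htrans _ _ _ ih ?_
      have := h (fun j => if j ∈ S then y j else x j) i (y i) (by simpa [hi] using hxy i)
      convert this using 2
      ext j
      by_cases hj : j = i
      · subst hj; simp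
      · simp [hj]
  simpa using key Finset.univ

end Order

theorem ple_update {n : ℕ} {X : Type*} [Preorder X] {δ : Fin n → Pol} {x y : Fin n → X}
    {i : Fin n} {a b : X} (hab : ple (δ i) a b) (h : ∀ j, j ≠ i → ple (δ j) (x j) (y j)) (j : Fin n) :
    ple (δ j) (Function.update x i a j) (Function.update y i b j) := by
  by_cases hj : j = i
  · subst hj; simpa using hab
  · simpa [hj] using h j hj

/-! ## Closed and open elements of a canonical extension -/

section CanonicalExtension

variable {A : Type u} {C : Type v} [Lattice A] [BoundedOrder A] [CompleteLattice C]
  {e : BoundedLatticeHom A C}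

theorem PClosed.of_pInf {s : Pol} (S : Set A) : PClosed e s (pSup s.flip (e '' S)) := by
  cases s <;> exact ⟨S, rfl⟩

theorem PClosed.exists_eq {s : Pol} {x : C} (h : PClosed e s x) :
    ∃ S : Set A, x = pSup s.flip (e '' S) := by
  cases s <;> exact h

theorem PClosed.apply (s : Pol) (a : A) : PClosed e s (e a) := by
  cases s <;> exact ⟨{a}, by simp⟩

theorem map_pjoin (s : Pol) (a b : A) : e (pjoin s a b) = pjoin s (e a) (e b) := by
  cases s
  · exact map_sup e a b
  · exact map_inf e a b

theorem map_pzero (s : Pol) : e (pzero s) = pzero s := by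
  cases s
  · exact map_bot e
  · exact map_top e

theorem ple_map {s : Pol} {a b : A} (h : ple s a b) : ple s (e a) (e b) := by
  cases s
  · exact OrderHomClass.mono e h
  · exact OrderHomClass.mono e h

namespace IsCanonicalExtension

variable (he : IsCanonicalExtension e)
include he

/-- Compactness for directed families. -/
theorem exists_ple_of_pInf_ple {s : Pol} {X : Set A} (hne : X.Nonempty)
    (hX : ∀ a ∈ X, ∀ b ∈ X, ∃ c ∈ X, ple s c a ∧ ple s c b) {o : C} (ho : PClosed e s.flip o)
    (h : ple s (pSup s.flip (e '' X)) o) : ∃ a ∈ X, ple s (e a) o := by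
  -- Directedness yields one bound in `X` for the finite subset that compactness provides.
  have hfin : ∀ F : Finset A, ↑F ⊆ X → ∃ a ∈ X, ∀ b ∈ F, ple s a b := by
    classical
    intro F
    induction F using Finset.induction_on with
    | empty => intro _; obtain ⟨a, ha⟩ := hne; exact ⟨a, ha, by simp⟩
    | insert b F _ ih =>
      intro hF
      rw [Finset.coe_insert, Set.insert_subset_iff] at hF
      obtain ⟨a, ha, haF⟩ := ih hF.2
      obtain ⟨c, hc, hca, hcb⟩ := hX a ha b hF.1
      refine ⟨c, hc, fun d hd => ?_⟩
      rcases Finset.mem_insert.1 hd with rfl | hd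
      · exact hcb
      · exact ple_trans hca (haF d hd)
  cases s
  · obtain ⟨T, rfl⟩ := ho
    obtain ⟨S', T', hS, hT, hle⟩ := he.compact X T h
    obtain ⟨a, ha, haS⟩ := hfin S' hS
    refine ⟨a, ha, ?_⟩
    have h1 : a ≤ T'.sup id := le_trans (Finset.le_inf haS) hle
    refine le_trans (OrderHomClass.mono e h1) ?_
    rw [map_finset_sup]
    exact Finset.sup_le fun b hb => le_sSup ⟨b, hT hb, rfl⟩
  · obtain ⟨T, rfl⟩ := ho
    obtain ⟨S', T', hS, hT, hle⟩ := he.compact T X h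
    obtain ⟨a, ha, haS⟩ := hfin T' hT
    refine ⟨a, ha, ?_⟩
    have h1 : S'.inf id ≤ a := le_trans hle (Finset.sup_le haS)
    refine le_trans ?_ (OrderHomClass.mono e h1)
    rw [map_finset_inf]
    exact Finset.le_inf fun b hb => sInf_le ⟨b, hS hb, rfl⟩

/-- This is join-density for `pos` and meet-density for `neg`. -/
theorem ple_of_forall_closed {s : Pol} {x y : C}
    (h : ∀ k, PClosed e s k → ple s k x → ple s k y) : ple s x y := by
  cases s
  · obtain ⟨K, hK, rfl⟩ := he.join_dense x
    exact sSup_le fun k hk => h k (hK k hk) (le_sSup hk)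
  · obtain ⟨K, hK, rfl⟩ := he.meet_dense x
    exact le_sInf fun k hk => h k (hK k hk) (sInf_le hk)

theorem ple_of_forall_open {s : Pol} {x y : C}
    (h : ∀ o, PClosed e s.flip o → ple s y o → ple s x o) : ple s x y := by
  have := he.ple_of_forall_closed (s := s.flip) (x := y) (y := x)
    (fun k hk hky => by simpa using h k hk (by simpa using hky))
  simpa using this

/-- Interpolation between closed and open elements. -/
theorem exists_between {s : Pol} {x y : C} (hx : PClosed e s x) (hy : PClosed e s.flip y)
    (h : ple s x y) : ∃ a : A, ple s x (e a) ∧ ple s (e a) y := by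
  obtain ⟨S, rfl⟩ := hx.exists_eq
  -- The elements of $\mathbb A$ above `x` are closed under binary meets, and their meet is `x`, so
  -- compactness applies to them.
  refine he.exists_ple_of_pInf_ple (X := {a | ple s (pSup s.flip (e '' S)) (e a)})
    ⟨pzero s.flip, by simpa [map_pzero] using ple_pone s _⟩ ?_ hy ?_
  · intro a ha b hb
    refine ⟨pjoin s.flip a b, ?_, pmeet_ple_left _ _ _, pmeet_ple_right _ _ _⟩
    simp only [Set.mem_ofPred_eq, map_pjoin] at ha hb ⊢
    exact ple_pmeet.2 ⟨ha, hb⟩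
  · refine ple_trans (ple_pInf ?_) h
    rintro _ ⟨a, ha, rfl⟩
    exact pInf_ple ⟨a, pInf_ple ⟨a, ha, rfl⟩, rfl⟩

/-- Interpolation characterizes closedness: by density of the open elements, `x` is then the meet of
the elements of $\mathbb A$ above it. All nontrivial closedness proofs below go through this
criterion. -/
theorem pclosed_of_forall_open {s : Pol} {x : C}
    (h : ∀ o, PClosed e s.flip o → ple s x o → ∃ a : A, ple s x (e a) ∧ ple s (e a) o) :
    PClosed e s x := by
  have : x = pSup s.flip (e '' {a | ple s x (e a)}) := by
    refine ple_antisymm (s := s) (ple_pInf ?_) (he.ple_of_forall_open fun o ho hxo => ?_)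
    · rintro _ ⟨a, ha, rfl⟩
      exact ha
    · obtain ⟨a, hxa, hao⟩ := h o ho hxo
      exact ple_trans (pInf_ple ⟨a, hxa, rfl⟩) hao
  rw [this]
  exact PClosed.of_pInf _

/-- For meets, the two defining sets are united. For joins, both elements are interpolated below the
same open element and the interpolants are joined. -/
theorem pclosed_pjoin {s : Pol} (t : Pol) {x y : C} (hx : PClosed e s x) (hy : PClosed e s y) :
    PClosed e s (pjoin t x y) := by
  by_cases ht : t = s.flip
  · subst ht
    obtain ⟨S, rfl⟩ := hx.exists_eq
    obtain ⟨T, rfl⟩ := hy.exists_eq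
    have : pjoin s.flip (pSup s.flip (e '' S)) (pSup s.flip (e '' T)) =
        pSup s.flip (e '' (S ∪ T)) := by
      rw [Set.image_union]
      cases s
      · exact sInf_union.symm
      · exact sSup_union.symm
    rw [this]
    exact PClosed.of_pInf _
  · obtain rfl := Pol.eq_of_ne_flip ht
    refine he.pclosed_of_forall_open fun o ho hxo => ?_
    obtain ⟨h1, h2⟩ := pjoin_ple.1 hxo
    obtain ⟨a, ha, hao⟩ := he.exists_between hx ho h1
    obtain ⟨b, hb, hbo⟩ := he.exists_between hy ho h2
    refine ⟨pjoin t a b, ?_, ?_⟩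
    · rw [map_pjoin]
      exact pjoin_ple.2 ⟨ple_trans ha (ple_pjoin_left _ _ _), ple_trans hb (ple_pjoin_right _ _ _)⟩
    · rw [map_pjoin]
      exact pjoin_ple.2 ⟨hao, hbo⟩

/-- If the meet of two closed elements lies below an element of `A`, so does the meet of two
elements of `A` above them. -/
theorem exists_pmeet_ple {s : Pol} {x y : C} (hx : PClosed e s x) (hy : PClosed e s y) {o : C}
    (ho : PClosed e s.flip o) (h : ple s (pjoin s.flip x y) o) :
    ∃ a b : A, ple s x (e a) ∧ ple s y (e b) ∧ ple s (e (pjoin s.flip a b)) o := by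
  obtain ⟨c, ⟨a, b, ha, hb, rfl⟩, hc⟩ := he.exists_ple_of_pInf_ple
    (X := {c | ∃ a b : A, ple s x (e a) ∧ ple s y (e b) ∧ c = pjoin s.flip a b})
    ⟨_, pzero s.flip, pzero s.flip, by simpa [map_pzero] using ple_pone s _,
      by simpa [map_pzero] using ple_pone s _, rfl⟩
    (by
      rintro _ ⟨a, b, ha, hb, rfl⟩ _ ⟨a', b', ha', hb', rfl⟩
      refine ⟨pjoin s.flip (pjoin s.flip a a') (pjoin s.flip b b'),
        ⟨_, _, ?_, ?_, rfl⟩, ?_, ?_⟩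
      · rw [map_pjoin]; exact ple_pmeet.2 ⟨ha, ha'⟩
      · rw [map_pjoin]; exact ple_pmeet.2 ⟨hb, hb'⟩
      · exact ple_pmeet.2 ⟨ple_trans (pmeet_ple_left _ _ _) (pmeet_ple_left _ _ _),
          ple_trans (pmeet_ple_right _ _ _) (pmeet_ple_left _ _ _)⟩
      · exact ple_pmeet.2 ⟨ple_trans (pmeet_ple_left _ _ _) (pmeet_ple_right _ _ _),
          ple_trans (pmeet_ple_right _ _ _) (pmeet_ple_right _ _ _)⟩)
    ho (by
      refine ple_trans (ple_pmeet.2 ⟨?_, ?_⟩) h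
      · obtain ⟨S, rfl⟩ := hx.exists_eq
        refine ple_pInf ?_
        rintro _ ⟨a, ha, rfl⟩
        refine pInf_ple ⟨a, ⟨a, pzero s.flip, pInf_ple ⟨a, ha, rfl⟩,
          by simpa [map_pzero] using ple_pone s _, ?_⟩, rfl⟩
        exact ple_antisymm (ple_pmeet.2 ⟨ple_refl s a, ple_pone s a⟩) (pmeet_ple_left _ _ _)
      · obtain ⟨S, rfl⟩ := hy.exists_eq
        refine ple_pInf ?_
        rintro _ ⟨a, ha, rfl⟩
        refine pInf_ple ⟨a, ⟨pzero s.flip, a, by simpa [map_pzero] using ple_pone s _,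
          pInf_ple ⟨a, ha, rfl⟩, ?_⟩, rfl⟩
        exact ple_antisymm (ple_pmeet.2 ⟨ple_pone s a, ple_refl s a⟩) (pmeet_ple_right _ _ _))
  exact ⟨a, b, ha, hb, hc⟩

end IsCanonicalExtension

/-! ## Extensions of operations -/

/-- The common form of the `σ`-extension (`s = pos`) and the `π`-extension (`s = neg`) of an
operation that is monotone from the product of the orders `ple (δ i)` to the order `ple s`. -/
def pExt (e : A → C) (s : Pol) {n : ℕ} (δ : Fin n → Pol) (f : (Fin n → A) → A) (x : Fin n → C) :
    C :=
  pSup s {y | ∃ k : Fin n → C, (∀ i, PClosed e (δ i) (k i)) ∧ (∀ i, ple (δ i) (k i) (x i)) ∧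
    y = pSup s.flip (e '' {b | ∃ a : Fin n → A, (∀ i, ple (δ i) (k i) (e (a i))) ∧ b = f a})}

/-- Measured against the order `ple (L.fam c)` on values, every connective is monotone for the
orders `δ i = fam · eps i` and preserves joins. This removes the distinction between $\sigma$- and
$\pi$-extensions. -/
theorem canOp_eq_pExt {L : Sig.{w}} (𝔸 : LEAlgebra L A) (c : L.Conn) :
    𝔸.canOp e c = pExt e (L.fam c) (fun i => (L.fam c).mul (L.eps c i)) (𝔸.op c) := by
  have him : ∀ P : (Fin (L.ar c) → A) → Prop,
      {z | ∃ a, P a ∧ z = e (𝔸.op c a)} = e '' {b | ∃ a, P a ∧ b = 𝔸.op c a} := by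
    intro P
    ext z
    constructor
    · rintro ⟨a, ha, rfl⟩
      exact ⟨_, ⟨a, ha, rfl⟩, rfl⟩
    · rintro ⟨_, ⟨a, ha, rfl⟩, rfl⟩
      exact ⟨a, ha, rfl⟩
  funext x
  unfold LEAlgebra.canOp
  generalize L.fam c = s
  cases s
  · simp only [sigmaExt, pExt, Pol.pos_mul, him]
    rfl
  · simp only [piExt, pExt, Pol.neg_mul, him, ple_flip]
    rfl

section Ext

variable {s : Pol} {n : ℕ} {δ : Fin n → Pol} {f : (Fin n → A) → A}

theorem pExt_mono {x y : Fin n → C} (h : ∀ i, ple (δ i) (x i) (y i)) :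
    ple s (pExt e s δ f x) (pExt e s δ f y) := by
  refine pSup_ple ?_
  rintro _ ⟨k, hk, hkx, rfl⟩
  exact ple_pSup ⟨k, hk, fun i => ple_trans (hkx i) (h i), rfl⟩

theorem pExt_ple_map {x : Fin n → C} {a : Fin n → A} (h : ∀ i, ple (δ i) (x i) (e (a i))) :
    ple s (pExt e s δ f x) (e (f a)) := by
  refine pSup_ple ?_
  rintro _ ⟨k, hk, hkx, rfl⟩
  exact pInf_ple ⟨_, ⟨a, fun i => ple_trans (hkx i) (h i), rfl⟩, rfl⟩

variable (he : IsCanonicalExtension e)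
  (hmono : ∀ a b : Fin n → A, (∀ i, ple (δ i) (a i) (b i)) → ple s (f a) (f b))
include he hmono

omit hmono in
theorem IsCanonicalExtension.ple_of_ple_map {t : Pol} {a b : A} (h : ple t (e a) (e b)) :
    ple t a b := by
  have : e (pjoin t a b) = e b := by rw [map_pjoin]; exact pjoin_eq_right h
  rw [← he.injective this]
  exact ple_pjoin_left _ _ _

theorem map_ple_pExt {x : Fin n → C} {a : Fin n → A} (h : ∀ i, ple (δ i) (e (a i)) (x i)) :
    ple s (e (f a)) (pExt e s δ f x) := by
  refine ple_trans ?_ (ple_pSup ⟨fun i => e (a i), fun i => PClosed.apply _ _, h, rfl⟩)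
  refine ple_pInf ?_
  rintro _ ⟨_, ⟨b, hb, rfl⟩, rfl⟩
  exact ple_map (hmono a b fun i => he.ple_of_ple_map (hb i))

theorem pExt_map (a : Fin n → A) : pExt e s δ f (fun i => e (a i)) = e (f a) :=
  ple_antisymm (pExt_ple_map fun _ => ple_refl _ _)
    (map_ple_pExt he hmono fun _ => ple_refl _ _)

/-- The meet of the `e (f a)` for `a` above the closed tuple `k` lies below the extension at `k`.
This family is down-directed because `f` is monotone, so compactness selects one member. -/
theorem exists_ple_of_pExt_ple {k : Fin n → C} (hk : ∀ i, PClosed e (δ i) (k i)) {o : C}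
    (ho : PClosed e s.flip o) (h : ple s (pExt e s δ f k) o) :
    ∃ a : Fin n → A, (∀ i, ple (δ i) (k i) (e (a i))) ∧ ple s (e (f a)) o := by
  obtain ⟨_, ⟨a, ha, rfl⟩, hao⟩ := he.exists_ple_of_pInf_ple (s := s)
    (X := {b | ∃ a : Fin n → A, (∀ i, ple (δ i) (k i) (e (a i))) ∧ b = f a})
    ⟨_, fun i => pzero (δ i).flip, fun i => by simpa only [map_pzero] using ple_pone _ _, rfl⟩
    (by
      rintro _ ⟨a, ha, rfl⟩ _ ⟨b, hb, rfl⟩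
      refine ⟨_, ⟨fun i => pjoin (δ i).flip (a i) (b i), fun i => ?_, rfl⟩,
        hmono _ _ fun i => pmeet_ple_left _ _ _, hmono _ _ fun i => pmeet_ple_right _ _ _⟩
      rw [map_pjoin]
      exact ple_pmeet.2 ⟨ha i, hb i⟩)
    ho (ple_trans (b := pExt e s δ f k) (by
      unfold pExt
      exact ple_pSup ⟨k, hk, fun i => ple_refl _ _, rfl⟩) h)
  exact ⟨a, ha, hao⟩

/-- On open tuples the extension is approximated from below: a closed tuple `k` under `o`
interpolates through $\mathbb A$, so each meet in the definition lies under the join of the `e (f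
a)` with `a` below `o`. That family is up-directed, and compactness applies again. -/
theorem exists_ple_of_ple_pExt {o : Fin n → C} (ho : ∀ i, PClosed e (δ i).flip (o i)) {y : C}
    (hy : PClosed e s y) (h : ple s y (pExt e s δ f o)) :
    ∃ a : Fin n → A, (∀ i, ple (δ i) (e (a i)) (o i)) ∧ ple s y (e (f a)) := by
  obtain ⟨_, ⟨a, ha, rfl⟩, hao⟩ := he.exists_ple_of_pInf_ple (s := s.flip)
    (X := {b | ∃ a : Fin n → A, (∀ i, ple (δ i) (e (a i)) (o i)) ∧ b = f a})
    ⟨_, fun i => pzero (δ i), fun i => by simpa only [map_pzero] using pzero_ple _ _, rfl⟩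
    (by
      rintro _ ⟨a, ha, rfl⟩ _ ⟨b, hb, rfl⟩
      refine ⟨_, ⟨fun i => pjoin (δ i) (a i) (b i), fun i => ?_, rfl⟩, ?_, ?_⟩
      · rw [map_pjoin]
        exact pjoin_ple.2 ⟨ha i, hb i⟩
      · exact (ple_flip _ _ _).2 (hmono _ _ fun i => ple_pjoin_left _ _ _)
      · exact (ple_flip _ _ _).2 (hmono _ _ fun i => ple_pjoin_right _ _ _))
    (by simpa using hy) (by
      rw [ple_flip, Pol.flip_flip]
      refine ple_trans h (pSup_ple ?_)
      rintro _ ⟨k, hk, hko, rfl⟩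
      choose a hka hao using fun i => he.exists_between (hk i) (ho i) (hko i)
      exact ple_trans (pInf_ple ⟨_, ⟨a, hka, rfl⟩, rfl⟩) (ple_pSup ⟨_, ⟨a, hao, rfl⟩, rfl⟩))
  exact ⟨a, ha, by simpa using hao⟩

theorem pclosed_pExt {k : Fin n → C} (hk : ∀ i, PClosed e (δ i) (k i)) :
    PClosed e s (pExt e s δ f k) := by
  refine he.pclosed_of_forall_open fun o ho h => ?_
  obtain ⟨a, hka, hao⟩ := exists_ple_of_pExt_ple he hmono hk ho h
  exact ⟨_, pExt_ple_map hka, hao⟩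

theorem popen_pExt {o : Fin n → C} (ho : ∀ i, PClosed e (δ i).flip (o i)) :
    PClosed e s.flip (pExt e s δ f o) := by
  refine he.pclosed_of_forall_open fun y hy h => ?_
  obtain ⟨a, hao, hya⟩ := exists_ple_of_ple_pExt he hmono ho (by simpa using hy) (by simpa using h)
  exact ⟨f a, by simpa using map_ple_pExt he hmono hao, by simpa using hya⟩

/-- The extension of a coordinatewise join-preserving operation preserves nonempty joins. -/
theorem pExt_update_pSup_ple
    (hjoin : ∀ (i : Fin n) (x : Fin n → A) (a b : A),
      f (Function.update x i (pjoin (δ i) a b)) =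
        pjoin s (f (Function.update x i a)) (f (Function.update x i b)))
    (x : Fin n → C) (i : Fin n) {X : Set C} (hX : X.Nonempty) {z : C}
    (h : ∀ u ∈ X, ple s (pExt e s δ f (Function.update x i u)) z) :
    ple s (pExt e s δ f (Function.update x i (pSup (δ i) X))) z := by
  refine he.ple_of_forall_open fun o ho hzo => pSup_ple ?_
  rintro _ ⟨k, hk, hkx, rfl⟩
  have hki : ple (δ i) (k i) (pSup (δ i) X) := by simpa using hkx i
  have hkj : ∀ j, j ≠ i → ple (δ j) (k j) (x j) := fun j hj => by simpa [hj] using hkx j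
  -- `Y` collects the `b` admissible in coordinate `i`: some tuple above `k` elsewhere, completed by
  -- `b`, has its value under `o`. Every closed element below a member of `X` is below some `b` in
  -- `Y`, so $\bigvee X\le\bigvee Y$.
  let Y : Set A := {b | ∃ a : Fin n → A, (∀ j, j ≠ i → ple (δ j) (k j) (e (a j))) ∧
    ple s (e (f (Function.update a i b))) o}
  have hY : ∀ u ∈ X, ∀ u', PClosed e (δ i) u' → ple (δ i) u' u →
      ∃ b ∈ Y, ple (δ i) u' (e b) := by
    intro u hu u' hu' huu'
    obtain ⟨a, hka, hao⟩ := exists_ple_of_pExt_ple (s := s) (f := f) he hmono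
      (k := Function.update k i u') (δ := δ) (fun j => by
        by_cases hj : j = i
        · subst hj; simpa using hu'
        · simpa [hj] using hk j) ho
      (ple_trans (pExt_mono (ple_update huu' hkj)) (ple_trans (h u hu) hzo))
    refine ⟨a i, ⟨a, fun j hj => by simpa [hj] using hka j, by simpa using hao⟩, ?_⟩
    simpa using hka i
  have hXY : ple (δ i) (k i) (pSup (δ i) (e '' Y)) := by
    refine ple_trans hki (pSup_ple fun u hu => he.ple_of_forall_closed fun u' hu' huu' => ?_)
    obtain ⟨b, hb, hub⟩ := hY u hu u' hu' huu'
    exact ple_trans hub (ple_pSup ⟨b, hb, rfl⟩)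
  -- `Y` is nonempty because `X` is, and up-directed: meet the tuples off `i`, join the entries at
  -- `i`, and use join preservation. Compactness puts `k i` under a single `b`.
  obtain ⟨b, ⟨a, hka, hao⟩, hkb⟩ := he.exists_ple_of_pInf_ple (s := (δ i).flip) (X := Y) (o := k i)
    (by
      obtain ⟨u, hu⟩ := hX
      obtain ⟨b, hb, -⟩ := hY u hu (pzero (δ i))
        (by simpa only [map_pzero] using PClosed.apply (e := e) (δ i) (pzero (δ i))) (pzero_ple _ _)
      exact ⟨b, hb⟩)
    (by
      rintro b ⟨a, hka, hao⟩ b' ⟨a', hka', hao'⟩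
      refine ⟨pjoin (δ i) b b', ⟨fun j => pjoin (δ j).flip (a j) (a' j), fun j hj => ?_, ?_⟩, ?_, ?_⟩
      · rw [map_pjoin]
        exact ple_pmeet.2 ⟨hka j hj, hka' j hj⟩
      · rw [hjoin, map_pjoin]
        refine pjoin_ple.2 ⟨ple_trans (ple_map (hmono _ _ ?_)) hao,
          ple_trans (ple_map (hmono _ _ ?_)) hao'⟩
        · exact ple_update (ple_refl _ _) fun j _ => pmeet_ple_left _ _ _
        · exact ple_update (ple_refl _ _) fun j _ => pmeet_ple_right _ _ _
      · exact (ple_flip _ _ _).2 (ple_pjoin_left _ _ _)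
      · exact (ple_flip _ _ _).2 (ple_pjoin_right _ _ _))
    (by simpa using hk i) (by simpa using hXY)
  refine ple_trans (pInf_ple ⟨_, ⟨Function.update a i b, fun j => ?_, rfl⟩, rfl⟩) hao
  by_cases hj : j = i
  · subst hj; simpa using hkb
  · simpa [hj] using hka j hj

end Ext

end CanonicalExtension

/-! ## Monotonicity and substitution -/

section Eval

variable {L : Sig.{w}} {V W : Type} {A : Type u} [Lattice A] [BoundedOrder A]
  {op : (c : L.Conn) → (Fin (L.ar c) → A) → A}

/-- The operations are monotone according to their order-types. -/
def MonotoneOps (op : (c : L.Conn) → (Fin (L.ar c) → A) → A) : Prop :=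
  ∀ (c : L.Conn) (s : Pol) (x y : Fin (L.ar c) → A),
    (∀ i, ple (s.mul (L.eps c i)) (x i) (y i)) → ple s (op c x) (op c y)

omit [BoundedOrder A] in
-- Flipping the sign reverses premises and conclusion together, so one sign per connective is
-- enough.
theorem MonotoneOps.of_sign (σ : L.Conn → Pol)
    (h : ∀ (c : L.Conn) (x y : Fin (L.ar c) → A),
      (∀ i, ple ((σ c).mul (L.eps c i)) (x i) (y i)) → ple (σ c) (op c x) (op c y)) :
    MonotoneOps op := by
  intro c s x y hxy
  by_cases hs : s = (σ c).flip
  · subst hs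
    rw [ple_flip]
    refine h c y x fun i => ?_
    have := hxy i
    rwa [show (σ c).flip.mul (L.eps c i) = ((σ c).mul (L.eps c i)).flip by
      cases σ c
      · rfl
      · exact (Pol.flip_flip _).symm, ple_flip] at this
  · obtain rfl := Pol.eq_of_ne_flip hs
    exact h c x y hxy

theorem LEAlgebra.op_mono (𝔸 : LEAlgebra L A) (c : L.Conn) {x y : Fin (L.ar c) → A}
    (h : ∀ i, ple ((L.fam c).mul (L.eps c i)) (x i) (y i)) :
    ple (L.fam c) (𝔸.op c x) (𝔸.op c y) := by
  refine monotone_of_coordinatewise (R := fun i => ple ((L.fam c).mul (L.eps c i)))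
    (ple_refl _) (fun _ _ _ => ple_trans) (fun x i y hxy => ?_) h
  -- Preservation of $a\vee b=b$ gives monotonicity in one coordinate.
  have := 𝔸.op_join c i x (x i) y
  rw [pjoin_eq_right hxy, Function.update_eq_self] at this
  rw [this]
  exact ple_pjoin_left _ _ _

theorem LEAlgebra.monotoneOps (𝔸 : LEAlgebra L A) : MonotoneOps 𝔸.op :=
  .of_sign L.fam fun c _ _ => 𝔸.op_mono c

/-- The sign of an occurrence dictates the direction in which its variable may move; a variable
occurring with both signs has to keep its value. -/
theorem Term.eval_mono (hop : MonotoneOps op) (t : Term L V) {s : Pol} {v w : V → A}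
    (h : ∀ x r, t.Occ r x → ple (s.mul r) (v x) (w x)) :
    ple s (t.eval op v) (t.eval op w) := by
  induction t generalizing s with
  | var x => simpa [Term.eval] using h x .pos ⟨rfl, rfl⟩
  | bot => exact ple_refl s _
  | top => exact ple_refl s _
  | inf a b iha ihb =>
    have h1 := iha fun x r hx => h x r (Or.inl hx)
    have h2 := ihb fun x r hx => h x r (Or.inr hx)
    cases s
    · exact inf_le_inf h1 h2
    · exact inf_le_inf h1 h2
  | sup a b iha ihb =>
    have h1 := iha fun x r hx => h x r (Or.inl hx)
    have h2 := ihb fun x r hx => h x r (Or.inr hx)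
    cases s
    · exact sup_le_sup h1 h2
    · exact sup_le_sup h1 h2
  | app c args ih =>
    refine hop c s _ _ fun i => ih i fun x r hx => ?_
    rw [Pol.mul_assoc]
    refine h x _ ⟨i, ?_⟩
    rwa [Pol.mul_mul_cancel]

theorem Term.eval_congr (t : Term L V) {v w : V → A}
    (h : ∀ x, t.Occurs x → v x = w x) : t.eval op v = t.eval op w := by
  induction t with
  | var x => exact h x ⟨.pos, rfl, rfl⟩
  | bot => rfl
  | top => rfl
  | inf a b iha ihb =>
    exact congrArg₂ (· ⊓ ·) (iha fun x ⟨r, hx⟩ => h x ⟨r, Or.inl hx⟩)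
      (ihb fun x ⟨r, hx⟩ => h x ⟨r, Or.inr hx⟩)
  | sup a b iha ihb =>
    exact congrArg₂ (· ⊔ ·) (iha fun x ⟨r, hx⟩ => h x ⟨r, Or.inl hx⟩)
      (ihb fun x ⟨r, hx⟩ => h x ⟨r, Or.inr hx⟩)
  | app c args ih =>
    refine congrArg (op c) (funext fun i => ih i fun x ⟨r, hx⟩ => h x ⟨(L.eps c i).mul r, i, ?_⟩)
    rwa [Pol.mul_mul_cancel]

theorem Term.eval_update_of_not_occurs [DecidableEq V] {t : Term L V} {x : V}
    (h : ¬ t.Occurs x) (v : V → A) (a : A) :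
    t.eval op (Function.update v x a) = t.eval op v :=
  t.eval_congr fun y hy => Function.update_of_ne (by rintro rfl; exact h hy) _ _

theorem Term.eval_subst (t : Term L V) (σ : V → Term L W) (v : W → A) :
    (t.subst σ).eval op v = t.eval op fun x => (σ x).eval op v := by
  induction t with
  | var x => rfl
  | bot => rfl
  | top => rfl
  | inf a b iha ihb => exact congrArg₂ (· ⊓ ·) iha ihb
  | sup a b iha ihb => exact congrArg₂ (· ⊔ ·) iha ihb
  | app c args ih => exact congrArg (op c) (funext ih)

theorem Term.eval_subst1 [DecidableEq V] (t : Term L V) (x : V) (a : Term L V) (v : V → A) :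
    (t.subst1 x a).eval op v = t.eval op (Function.update v x (a.eval op v)) := by
  rw [Term.subst1, Term.eval_subst]
  congr 1
  funext y
  by_cases hy : y = x
  · subst hy; simp
  · simp [hy, Term.eval]

theorem Term.eval_join (s : Pol) (a b : Term L V) (v : V → A) :
    (Term.join s a b).eval op v = pjoin s (a.eval op v) (b.eval op v) := by
  cases s <;> rfl

theorem Term.eval_zero (s : Pol) (v : V → A) :
    (Term.zero s : Term L V).eval op v = pzero s := by
  cases s <;> rfl

theorem Term.eval_update {n : ℕ} (φ : Fin n → Term L V) (i : Fin n) (a : Term L V) (v : V → A) :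
    (fun j => (Function.update φ i a j).eval op v) =
      Function.update (fun j => (φ j).eval op v) i (a.eval op v) := by
  funext j
  by_cases hj : j = i
  · subst hj; simp
  · simp [hj]

/-- The inequality holds under the assignment `v`. -/
def Ineq.Sat (op : (c : L.Conn) → (Fin (L.ar c) → A) → A) (v : V → A) (q : Ineq L V) : Prop :=
  q.lhs.eval op v ≤ q.rhs.eval op v

theorem Ineq.sat_of {s : Pol} {a b : Term L V} {v : V → A} :
    (Ineq.of s a b).Sat op v ↔ ple s (a.eval op v) (b.eval op v) := by
  cases s <;> rfl

theorem Ineq.sat_congr {q : Ineq L V} {v w : V → A} (h : ∀ x, q.Occurs x → v x = w x) :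
    q.Sat op v ↔ q.Sat op w := by
  unfold Ineq.Sat
  rw [q.lhs.eval_congr fun x hx => h x (Or.inl hx), q.rhs.eval_congr fun x hx => h x (Or.inr hx)]

theorem Ineq.sat_update_of_not_occurs [DecidableEq V] {q : Ineq L V} {x : V}
    (h : ¬ q.Occurs x) (v : V → A) (a : A) :
    q.Sat op (Function.update v x a) ↔ q.Sat op v :=
  Ineq.sat_congr fun y hy => Function.update_of_ne (by rintro rfl; exact h hy) _ _

theorem Ineq.sat_subst1 [DecidableEq V] (q : Ineq L V) (x : V) (a : Term L V) (v : V → A) :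
    (q.subst1 x a).Sat op v ↔ q.Sat op (Function.update v x (a.eval op v)) := by
  unfold Ineq.Sat Ineq.subst1
  rw [Term.eval_subst1, Term.eval_subst1]

theorem Term.bigJoin_ple {s : Pol} {l : List (Term L V)} {v : V → A} {a : A} :
    ple s ((Term.bigJoin s l).eval op v) a ↔ ∀ t ∈ l, ple s (t.eval op v) a := by
  induction l with
  | nil => simp [Term.bigJoin, Term.eval_zero, pzero_ple]
  | cons t l ih =>
    cases l with
    | nil => simp [Term.bigJoin]
    | cons t' l =>
      rw [Term.bigJoin, Term.eval_join, pjoin_ple, ih]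
      simp

/-- Replacing the value of a variable by a larger one makes an inequality weaker if the left-hand
side is negative and the right-hand side positive in it; dually for smaller values. -/
theorem Ineq.Sat.of_update [DecidableEq V] (hop : MonotoneOps op) {q : Ineq L V} {x : V} {s : Pol}
    (hl : ¬ q.lhs.Occ s x) (hr : ¬ q.rhs.Occ s.flip x) {v : V → A} {a : A}
    (h : q.Sat op (Function.update v x a)) (ha : ple s a (v x)) : q.Sat op v := by
  have hl' : q.lhs.eval op v ≤ q.lhs.eval op (Function.update v x a) := by
    refine q.lhs.eval_mono hop (s := .pos) fun y r hy => ?_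
    by_cases hyx : y = x
    · subst hyx
      have : r = s.flip := Pol.eq_of_ne_flip fun h => hl (by simpa [h] using hy)
      subst this
      simpa using ha
    · simpa [hyx] using ple_refl _ _
  have hr' : q.rhs.eval op (Function.update v x a) ≤ q.rhs.eval op v := by
    refine q.rhs.eval_mono hop (s := .pos) fun y r hy => ?_
    by_cases hyx : y = x
    · subst hyx
      have : r = s := Pol.eq_of_ne_flip fun h => hr (by simpa [h] using hy)
      subst this
      simpa using ha
    · simpa [hyx] using ple_refl _ _
  exact hl'.trans (h.trans hr')

end Eval

/-! ## Soundness of preprocessing -/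

section Preprocessing

variable {L : Sig.{w}} {A : Type u} [Lattice A] [BoundedOrder A]

theorem Distr.eval_eq (𝔸 : LEAlgebra L A) (v : ℕ → A) {s : Pol} {t t' : Form L}
    (h : Distr s t t') : t.eval 𝔸.op v = t'.eval 𝔸.op v := by
  induction h with
  | root s c hc φ i a b hφ =>
    subst hc
    simp only [Term.eval_join, Term.eval, Term.eval_update]
    rw [← 𝔸.op_join, ← Term.eval_join, ← hφ, Function.update_eq_self]
  | inf_left s a a' b _ ih => simp only [Term.eval, ih]
  | inf_right s a b b' _ ih => simp only [Term.eval, ih]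
  | sup_left s a a' b _ ih => simp only [Term.eval, ih]
  | sup_right s a b b' _ ih => simp only [Term.eval, ih]
  | arg s c φ i a _ ih =>
    simp only [Term.eval, Term.eval_update]
    rw [← ih, Function.update_eq_self]

/-- When the variable is uniform, its extreme value gives the strongest instance of the inequality.
-/
theorem Ineq.valid_subst1_iff {op : (c : L.Conn) → (Fin (L.ar c) → A) → A} (hop : MonotoneOps op)
    {q : Ineq L ℕ} {p : ℕ} {s : Pol} (hl : ¬ q.lhs.Occ s p) (hr : ¬ q.rhs.Occ s.flip p) :
    q.Valid op ↔ (q.subst1 p (Term.zero s)).Valid op := by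
  constructor
  · intro h v
    exact (q.sat_subst1 p _ v).2 (h _)
  · intro h v
    have := (q.sat_subst1 p _ v).1 (h v)
    exact this.of_update hop hl hr (by rw [Term.eval_zero]; exact pzero_ple _ _)

/-- It is used in $\mathbb A$ from left to right and in $\mathbb A^\delta$ from right to left. -/
theorem Preprocess.valid_iff (𝔸 : LEAlgebra L A) {q : Ineq L ℕ} {Q : List (Ineq L ℕ)}
    (h : Preprocess q Q) : q.Valid 𝔸.op ↔ ∀ r ∈ Q, r.Valid 𝔸.op := by
  induction h with
  | done q => simp
  | elim_bot α β p Q hα hβ _ ih =>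
    rw [← ih]
    exact Ineq.valid_subst1_iff (q := ⟨α, β⟩) 𝔸.monotoneOps (s := .pos) hα hβ
  | elim_top α β p Q hα hβ _ ih =>
    rw [← ih]
    exact Ineq.valid_subst1_iff (q := ⟨α, β⟩) 𝔸.monotoneOps (s := .neg) hα hβ
  | distr_left α α' β Q h _ ih =>
    rw [← ih]
    simp only [Ineq.Valid, h.eval_eq 𝔸]
  | distr_right α β β' Q h _ ih =>
    rw [← ih]
    simp only [Ineq.Valid, h.eval_eq 𝔸]
  | split_inf α β γ Q Q' _ _ ih ih' =>
    simp only [List.mem_append, or_imp, forall_and, ← ih, ← ih']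
    simp only [Ineq.Valid, Term.eval, le_inf_iff, forall_and]
  | split_sup α β γ Q Q' _ _ ih ih' =>
    simp only [List.mem_append, or_imp, forall_and, ← ih, ← ih']
    simp only [Ineq.Valid, Term.eval, sup_le_iff, forall_and]

end Preprocessing

/-! ## The canonical extension of an `L`-algebra -/

section CanonicalAlgebra

variable {L : Sig.{w}} {A : Type u} {C : Type v} [Lattice A] [BoundedOrder A] [CompleteLattice C]
  {e : BoundedLatticeHom A C} (he : IsCanonicalExtension e) (𝔸 : LEAlgebra L A)
include he

theorem canOp_update_pSup_ple (c : L.Conn) (x : Fin (L.ar c) → C) (i : Fin (L.ar c)) {X : Set C}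
    (hX : X.Nonempty) {z : C}
    (h : ∀ u ∈ X, ple (L.fam c) (𝔸.canOp e c (Function.update x i u)) z) :
    ple (L.fam c)
      (𝔸.canOp e c (Function.update x i (pSup ((L.fam c).mul (L.eps c i)) X))) z := by
  rw [canOp_eq_pExt] at h ⊢
  exact pExt_update_pSup_ple he (δ := fun i => (L.fam c).mul (L.eps c i))
    (fun _ _ => 𝔸.op_mono c) (𝔸.op_join c) x i hX h

omit he in
theorem canOp_mono (c : L.Conn) {x y : Fin (L.ar c) → C}
    (h : ∀ i, ple ((L.fam c).mul (L.eps c i)) (x i) (y i)) :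
    ple (L.fam c) (𝔸.canOp e c x) (𝔸.canOp e c y) := by
  rw [canOp_eq_pExt]
  exact pExt_mono h

theorem canOp_map (c : L.Conn) (a : Fin (L.ar c) → A) :
    𝔸.canOp e c (fun i => e (a i)) = e (𝔸.op c a) := by
  rw [canOp_eq_pExt]
  exact pExt_map (δ := fun i => (L.fam c).mul (L.eps c i)) he (fun _ _ => 𝔸.op_mono c) a

omit he in
theorem canOp_update_pzero (c : L.Conn) (hc : ¬ L.reg c) (i : Fin (L.ar c))
    (x : Fin (L.ar c) → C) :
    𝔸.canOp e c (Function.update x i (pzero ((L.fam c).mul (L.eps c i)))) = pzero (L.fam c) := by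
  refine ple_antisymm (s := L.fam c) ?_ (pzero_ple _ _)
  -- The tuple lies below the tuple of $\mathbb A$ with the greatest entries off `i`, where
  -- `op_zero` gives the value.
  rw [← map_pzero (e := e), ← map_pzero (e := e), canOp_eq_pExt,
    ← 𝔸.op_zero c hc i fun j => pzero ((L.fam c).mul (L.eps c j)).flip]
  refine pExt_ple_map fun j => ?_
  by_cases hj : j = i
  · subst hj
    simpa using ple_refl _ _
  · simpa [hj, map_pzero] using ple_pone _ _

/-- The canonical extension of an `L`-algebra is an `L`-algebra. -/
def LEAlgebra.can : LEAlgebra L C where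
  op := 𝔸.canOp e
  op_join c i x a b := by
    refine ple_antisymm (s := L.fam c) ?_ (pjoin_ple.2 ⟨canOp_mono 𝔸 c ?_, canOp_mono 𝔸 c ?_⟩)
    · have hab : pjoin ((L.fam c).mul (L.eps c i)) a b =
          pSup ((L.fam c).mul (L.eps c i)) {a, b} := by
        cases (L.fam c).mul (L.eps c i)
        · exact sSup_pair.symm
        · exact sInf_pair.symm
      rw [hab]
      refine canOp_update_pSup_ple he 𝔸 c x i ⟨a, by simp⟩ ?_
      rintro u (rfl | rfl)
      · exact ple_pjoin_left _ _ _
      · exact ple_pjoin_right _ _ _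
    · exact ple_update (ple_pjoin_left _ _ _) fun j _ => ple_refl _ _
    · exact ple_update (ple_pjoin_right _ _ _) fun j _ => ple_refl _ _
  op_zero c hc i x := canOp_update_pzero 𝔸 c hc i x

end CanonicalAlgebra

/-! ## Interpretation of the extended language -/

section Star

variable {L : Sig.{w}} {A : Type u} {C : Type v} [Lattice A] [BoundedOrder A] [CompleteLattice C]

/-- The residual of `canOp c` in coordinate `i`. If `c` is regular, this is the adjoint of the
normalization of `c`, up to a value that is irrelevant when the side condition fails. -/
def resOp (𝔸 : LEAlgebra L A) (e : BoundedLatticeHom A C) (c : L.Conn) (i : Fin (L.ar c))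
    (x : Fin (L.ar c) → C) : C :=
  pSup ((L.fam c).mul (L.eps c i))
    {u | ple (L.fam c) (𝔸.canOp e c (Function.update x i u)) (x i)}

/-- The operations of the extended language on a canonical extension. -/
def starOp (𝔸 : LEAlgebra L A) (e : BoundedLatticeHom A C) :
    (c : L.star.Conn) → (Fin (L.star.ar c) → C) → C
  | .base c => 𝔸.canOp e c
  -- Normalizations never arise in a reduction (`CloConn` excludes them), so any monotone
  -- interpretation serves here.
  | .norm c _ => 𝔸.canOp e c
  | .res c i => resOp 𝔸 e c i

theorem eps_res_self (c : L.Conn) (i : Fin (L.ar c)) :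
    L.star.eps (StarConn.res c i) i = L.eps c i := by
  simp [Sig.star]

theorem mul_eps_res_self (c : L.Conn) (i : Fin (L.ar c)) :
    ((L.fam c).mul (L.eps c i)).mul (L.star.eps (StarConn.res c i) i) = L.fam c := by
  rw [eps_res_self]
  cases L.fam c <;> cases L.eps c i <;> rfl

theorem mul_eps_res_of_ne (c : L.Conn) {i j : Fin (L.ar c)} (h : j ≠ i) :
    ((L.fam c).mul (L.eps c i)).mul (L.star.eps (StarConn.res c i) j) =
      ((L.fam c).mul (L.eps c j)).flip := by
  have : L.star.eps (StarConn.res c i) j =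
      match L.eps c i with
      | .pos => (L.eps c j).flip
      | .neg => L.eps c j := if_neg h
  rw [this]
  cases L.fam c <;> cases L.eps c i <;> cases L.eps c j <;> rfl

theorem flip_mul (s t : Pol) : s.flip.mul t = (s.mul t).flip := by
  cases s <;> cases t <;> rfl

variable (𝔸 : LEAlgebra L A) (e : BoundedLatticeHom A C)

/-- The order-types of the residuals are right: enlarging the bound enlarges the set whose join is
taken, and enlarging another argument of the connective shrinks it. -/
theorem starOp_mono : MonotoneOps (starOp 𝔸 e) := by
  refine .of_sign (fun c : StarConn L => match c with
    | .base c => L.fam c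
    | .norm c _ => L.fam c
    | .res c i => (L.fam c).mul (L.eps c i)) ?_
  rintro (c | ⟨c, hc⟩ | ⟨c, i⟩) x y h
  · exact canOp_mono 𝔸 c h
  · exact canOp_mono 𝔸 c h
  · refine pSup_ple fun u hu => ple_pSup ?_
    have hi : ple (L.fam c) (x i) (y i) := by
      have := h i
      rwa [mul_eps_res_self] at this
    refine ple_trans (canOp_mono 𝔸 c (ple_update (ple_refl _ u) fun j hj => ?_)) (ple_trans hu hi)
    have := h j
    rwa [mul_eps_res_of_ne c hj, ple_flip] at this

variable {e}

/-- The set of `u` with $f(\dots,u,\dots)\le z$ is a down-set, nonempty exactly when it contains the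
least element; this is the first conjunct. If so, preservation of nonempty joins puts its join, the
residual, into it. For a regular connective the first conjunct is the side condition, for a normal
one it is automatic. -/
theorem canOp_ple_iff (he : IsCanonicalExtension e) (c : L.Conn) (i : Fin (L.ar c))
    (x : Fin (L.ar c) → C) (z : C) :
    ple (L.fam c) (𝔸.canOp e c x) z ↔
      ple (L.fam c)
        (𝔸.canOp e c (Function.update x i (pzero ((L.fam c).mul (L.eps c i))))) z ∧
      ple ((L.fam c).mul (L.eps c i)) (x i) (resOp 𝔸 e c i (Function.update x i z)) := by
  constructor
  · intro h
    refine ⟨ple_trans (canOp_mono 𝔸 c fun j => ?_) h, ple_pSup (by simpa using h)⟩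
    by_cases hj : j = i
    · subst hj
      simpa using pzero_ple _ _
    · simpa [hj] using ple_refl _ _
  · rintro ⟨h0, h⟩
    have hx : ple (L.fam c) (𝔸.canOp e c x) (𝔸.canOp e c
        (Function.update x i (resOp 𝔸 e c i (Function.update x i z)))) := by
      refine canOp_mono 𝔸 c fun j => ?_
      by_cases hj : j = i
      · subst hj
        simpa using h
      · simpa [hj] using ple_refl _ _
    refine ple_trans hx (canOp_update_pSup_ple he 𝔸 c x i
      ⟨pzero ((L.fam c).mul (L.eps c i)), by simpa using h0⟩ fun u hu => by simpa using hu)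

theorem canOp_ple_iff_of_normal (he : IsCanonicalExtension e) (c : L.Conn) (hc : ¬ L.reg c)
    (i : Fin (L.ar c)) (x : Fin (L.ar c) → C) (z : C) :
    ple (L.fam c) (𝔸.canOp e c x) z ↔
      ple ((L.fam c).mul (L.eps c i)) (x i) (resOp 𝔸 e c i (Function.update x i z)) := by
  rw [canOp_ple_iff 𝔸 he c i, canOp_update_pzero 𝔸 c hc]
  exact and_iff_right (pzero_ple _ _)

/-! ## Behaviour on closed and open elements -/

section Closed

variable (he : IsCanonicalExtension e)
include he

theorem pclosed_canOp (c : L.Conn) {s : Pol} {x : Fin (L.ar c) → C}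
    (hx : ∀ i, PClosed e (s.mul (L.eps c i)) (x i)) : PClosed e s (𝔸.canOp e c x) := by
  rw [canOp_eq_pExt]
  by_cases hs : s = (L.fam c).flip
  · subst hs
    simp only [flip_mul] at hx
    exact popen_pExt he (fun _ _ => 𝔸.op_mono c) hx
  · obtain rfl := Pol.eq_of_ne_flip hs
    exact pclosed_pExt he (fun _ _ => 𝔸.op_mono c) hx

theorem exists_ple_of_canOp_ple (c : L.Conn) {s : Pol} {x : Fin (L.ar c) → C}
    (hx : ∀ i, PClosed e (s.mul (L.eps c i)) (x i)) {o : C} (ho : PClosed e s.flip o)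
    (h : ple s (𝔸.canOp e c x) o) :
    ∃ a : Fin (L.ar c) → A, (∀ i, ple (s.mul (L.eps c i)) (x i) (e (a i))) ∧
      ple s (e (𝔸.op c a)) o := by
  rw [canOp_eq_pExt] at h
  by_cases hs : s = (L.fam c).flip
  · subst hs
    simp only [flip_mul, ple_flip] at hx h ⊢
    exact exists_ple_of_ple_pExt he (fun _ _ => 𝔸.op_mono c) hx (by simpa using ho) h
  · obtain rfl := Pol.eq_of_ne_flip hs
    exact exists_ple_of_pExt_ple he (fun _ _ => 𝔸.op_mono c) hx ho h

/-- A closed element below a residual of closed and open elements is trivial or is witnessed to be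
so by elements of `A`. -/
theorem exists_of_ple_resOp (c : L.Conn) (i : Fin (L.ar c)) {x : Fin (L.ar c) → C}
    (hi : PClosed e (L.fam c).flip (x i))
    (hj : ∀ j, j ≠ i → PClosed e ((L.fam c).mul (L.eps c j)) (x j)) {k : C}
    (hk : PClosed e ((L.fam c).mul (L.eps c i)) k)
    (h : ple ((L.fam c).mul (L.eps c i)) k (resOp 𝔸 e c i x)) :
    k = pzero ((L.fam c).mul (L.eps c i)) ∨
      ∃ (a : Fin (L.ar c) → A) (d : A), ple ((L.fam c).mul (L.eps c i)) k (e (a i)) ∧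
        (∀ j, j ≠ i → ple ((L.fam c).mul (L.eps c j)) (x j) (e (a j))) ∧
        ple (L.fam c) (e (𝔸.op c a)) (e d) ∧ ple (L.fam c) (e d) (x i) := by
  -- If the set defining the residual is nonempty, the value at `k` lies below `x i`; interpolating
  -- first the value and then the arguments yields `d` and `a`. If it is empty, the residual is the
  -- least element, and so is `k`.
  by_cases hX : {u | ple (L.fam c) (𝔸.canOp e c (Function.update x i u)) (x i)}.Nonempty
  · right
    have hkx : ple (L.fam c) (𝔸.canOp e c (Function.update x i k)) (x i) := by
      refine ple_trans (canOp_mono 𝔸 c (ple_update h fun j _ => ple_refl _ _))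
        (canOp_update_pSup_ple he 𝔸 c x i hX fun u hu => hu)
    have hcl : ∀ j, PClosed e ((L.fam c).mul (L.eps c j)) (Function.update x i k j) := by
      intro j
      by_cases hji : j = i
      · subst hji
        simpa using hk
      · simpa [hji] using hj j hji
    obtain ⟨d, hd, hdx⟩ := he.exists_between (pclosed_canOp 𝔸 he c hcl) hi hkx
    obtain ⟨a, ha, had⟩ := exists_ple_of_canOp_ple 𝔸 he c hcl (PClosed.apply _ d) hd
    exact ⟨a, d, by simpa using ha i, fun j hji => by simpa [hji] using ha j, had, hdx⟩
  · left
    rw [Set.not_nonempty_iff_eq_empty] at hX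
    refine ple_antisymm (s := (L.fam c).mul (L.eps c i)) (ple_trans h ?_) (pzero_ple _ _)
    rw [resOp, hX]
    exact pSup_ple fun u hu => absurd hu (Set.notMem_empty u)

/-- A closed element under the residual is under the witness `a i` from `exists_of_ple_resOp`, and
`a i` belongs to the set defining the residual. The criterion `pclosed_of_forall_open` then applies
in its dual form. -/
theorem pclosed_resOp (c : L.Conn) (i : Fin (L.ar c)) {x : Fin (L.ar c) → C}
    (hi : PClosed e (L.fam c).flip (x i))
    (hj : ∀ j, j ≠ i → PClosed e ((L.fam c).mul (L.eps c j)) (x j)) :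
    PClosed e ((L.fam c).mul (L.eps c i)).flip (resOp 𝔸 e c i x) := by
  refine he.pclosed_of_forall_open fun k hk h => ?_
  rw [Pol.flip_flip] at hk
  simp only [ple_flip] at h ⊢
  rcases exists_of_ple_resOp 𝔸 he c i hi hj hk h with rfl | ⟨a, d, hka, hxa, had, hdx⟩
  · exact ⟨pzero _, by rw [map_pzero]; exact pzero_ple _ _, by rw [map_pzero]; exact ple_refl _ _⟩
  · refine ⟨a i, ple_pSup ?_, hka⟩
    refine ple_trans ?_ (ple_trans had hdx)
    rw [← canOp_map he]
    refine canOp_mono 𝔸 c fun j => ?_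
    by_cases hji : j = i
    · subst hji
      simpa using ple_refl _ _
    · simpa [hji] using hxa j hji

end Closed

/-! ## Syntactically closed and open formulas -/

/-- Variables allowed in syntactically closed (`pos`) or open (`neg`) formulas. -/
def CloVar : Pol → PVar → Prop
  | _, .prop _ => True
  | s, .nom _ => s = .pos
  | s, .conom _ => s = .neg

/-- Connectives allowed in syntactically closed (`pos`) or open (`neg`) formulas. -/
def CloConn : Pol → StarConn L → Prop
  | _, .base _ => True
  | _, .norm _ _ => False
  | s, .res c i => s = ((L.fam c).mul (L.eps c i)).flip

/-- Syntactically closed (`pos`) and open (`neg`) formulas: in the tree with root signed `s`,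
nominals and residuals in `F*` are signed `+`, and co-nominals and residuals in `G*` are signed
`-`, for closed formulas and the other way round for open ones. -/
def Term.Clo : Pol → FormP L → Prop
  | s, .var x => CloVar s x
  | _, .bot => True
  | _, .top => True
  | s, .inf a b => a.Clo s ∧ b.Clo s
  | s, .sup a b => a.Clo s ∧ b.Clo s
  | s, .app c args => CloConn s c ∧ ∀ i, (args i).Clo (s.mul (L.star.eps c i))

theorem Term.clo_emb (t : Form L) (s : Pol) : t.emb.Clo s := by
  induction t generalizing s with
  | var x => trivial
  | bot => trivial
  | top => trivial
  | inf a b iha ihb => exact ⟨iha s, ihb s⟩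
  | sup a b iha ihb => exact ⟨iha s, ihb s⟩
  | app c args ih => exact ⟨trivial, fun i => ih i _⟩

theorem Term.clo_zero (s t : Pol) : (Term.zero t : FormP L).Clo s := by
  cases t <;> trivial

theorem Term.clo_join {s t : Pol} {a b : FormP L} (ha : a.Clo s) (hb : b.Clo s) :
    (Term.join t a b).Clo s := by
  cases t <;> exact ⟨ha, hb⟩

theorem Term.clo_bigJoin {s t : Pol} {l : List (FormP L)} (h : ∀ a ∈ l, a.Clo s) :
    (Term.bigJoin t l).Clo s := by
  induction l with
  | nil => exact Term.clo_zero s t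
  | cons a l ih =>
    cases l with
    | nil => exact h a (by simp)
    | cons b l =>
      exact Term.clo_join (h a (by simp)) (ih fun x hx => h x (List.mem_cons_of_mem _ hx))

/-- The sign hypothesis says that, in the tree with root `s`, every occurrence of `x` is signed `r`,
the sign at which `a` is syntactically closed or open. -/
theorem Term.Clo.subst1 {t : FormP L} {s r : Pol} {x : PVar} {a : FormP L} (ht : t.Clo s)
    (hx : ¬ t.Occ (s.mul r).flip x) (ha : a.Clo r) : (t.subst1 x a).Clo s := by
  unfold Term.subst1
  induction t generalizing s with
  | var y =>
    by_cases hy : y = x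
    · subst hy
      have : r = s := by
        cases s <;> cases r <;> first | rfl | exact absurd ⟨rfl, rfl⟩ hx
      subst this
      simpa [Term.subst] using ha
    · simpa [Term.subst, hy] using ht
  | bot => trivial
  | top => trivial
  | inf a b iha ihb =>
    exact ⟨iha ht.1 fun h => hx (Or.inl h), ihb ht.2 fun h => hx (Or.inr h)⟩
  | sup a b iha ihb =>
    exact ⟨iha ht.1 fun h => hx (Or.inl h), ihb ht.2 fun h => hx (Or.inr h)⟩
  | app c args ih =>
    refine ⟨ht.1, fun i => ih i (ht.2 i) fun h => hx ⟨i, ?_⟩⟩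
    have : (L.star.eps c i).mul (s.mul r).flip = ((s.mul (L.star.eps c i)).mul r).flip := by
      cases s <;> cases r <;> cases L.star.eps c i <;> rfl
    rwa [this]

/-! ## Approximation of closed values -/

/-- `x` is closed (`s = pos`) or open (`s = neg`), and is approximated by the values `T a` for the
`a ∈ A` above (`r = pos`) or below (`r = neg`) `κ`. -/
structure Approximates (e : BoundedLatticeHom A C) (r : Pol) (κ : C) (s : Pol) (x : C)
    (T : A → C) : Prop where
  closed : PClosed e s x
  mono : ∀ a b, ple r a b → ple s (T a) (T b)
  approx : ∀ b, ple s x (e b) → ∃ a, ple r κ (e a) ∧ ple s (T a) (e b)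

/-- The elements of $\mathbb A$ above `κ` are closed under finite meets, so finitely many hereditary
conditions can be met at once. -/
theorem exists_common_bound {e : BoundedLatticeHom A C} {r : Pol} {κ : C}
    {ι : Type*} (F : Finset ι) (P : ι → A → Prop)
    (hP : ∀ i a b, ple r a b → P i b → P i a)
    (h : ∀ i ∈ F, ∃ a, ple r κ (e a) ∧ P i a) :
    ∃ a, ple r κ (e a) ∧ ∀ i ∈ F, P i a := by
  classical
  induction F using Finset.induction_on with
  | empty => exact ⟨pzero r.flip, by rw [map_pzero]; exact ple_pone _ _, by simp⟩
  | insert i F _ ih =>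
    obtain ⟨a, ha, haF⟩ := ih fun j hj => h j (Finset.mem_insert_of_mem hj)
    obtain ⟨b, hb, hbi⟩ := h i (Finset.mem_insert_self i F)
    refine ⟨pjoin r.flip a b, by rw [map_pjoin]; exact ple_pmeet.2 ⟨ha, hb⟩, fun j hj => ?_⟩
    rcases Finset.mem_insert.1 hj with rfl | hj
    · exact hP _ _ _ (pmeet_ple_right _ _ _) hbi
    · exact hP _ _ _ (pmeet_ple_left _ _ _) (haF j hj)

/-! ### Stability of approximation under the connectives. -/

namespace Approximates

variable {r : Pol} {κ : C} {s : Pol}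

theorem const {x : C} (hx : PClosed e s x) : Approximates e r κ s x fun _ => x where
  closed := hx
  mono _ _ _ := ple_refl _ _
  approx b hb := ⟨pzero r.flip, by rw [map_pzero]; exact ple_pone _ _, hb⟩

theorem self (hκ : PClosed e r κ) : Approximates e r κ r κ e where
  closed := hκ
  mono _ _ := ple_map
  approx b hb := ⟨b, hb, ple_refl _ _⟩

theorem pair {x y : C} {T U : A → C} (hx : Approximates e r κ s x T)
    (hy : Approximates e r κ s y U) {a b : A} (ha : ple s x (e a)) (hb : ple s y (e b)) :
    ∃ d, ple r κ (e d) ∧ ple s (T d) (e a) ∧ ple s (U d) (e b) := by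
  obtain ⟨d, hd, hda⟩ := hx.approx a ha
  obtain ⟨d', hd', hdb⟩ := hy.approx b hb
  refine ⟨pjoin r.flip d d', by rw [map_pjoin]; exact ple_pmeet.2 ⟨hd, hd'⟩, ?_, ?_⟩
  · exact ple_trans (hx.mono _ _ (pmeet_ple_left _ _ _)) hda
  · exact ple_trans (hy.mono _ _ (pmeet_ple_right _ _ _)) hdb

/-- A bound on a join bounds both parts; a bound on a meet first has to be split by compactness
(`exists_pmeet_ple`). -/
theorem pjoin (he : IsCanonicalExtension e) (t : Pol) {x y : C} {T U : A → C}
    (hx : Approximates e r κ s x T) (hy : Approximates e r κ s y U) :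
    Approximates e r κ s (ALBA.pjoin t x y) fun a => ALBA.pjoin t (T a) (U a) where
  closed := he.pclosed_pjoin t hx.closed hy.closed
  mono a b hab := by
    have h1 := hx.mono a b hab
    have h2 := hy.mono a b hab
    by_cases ht : t = s.flip
    · subst ht
      exact ple_pmeet.2 ⟨ple_trans (pmeet_ple_left _ _ _) h1, ple_trans (pmeet_ple_right _ _ _) h2⟩
    · obtain rfl := Pol.eq_of_ne_flip ht
      exact pjoin_ple.2 ⟨ple_trans h1 (ple_pjoin_left _ _ _), ple_trans h2 (ple_pjoin_right _ _ _)⟩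
  approx b hb := by
    by_cases ht : t = s.flip
    · subst ht
      obtain ⟨a₁, a₂, h1, h2, h3⟩ := he.exists_pmeet_ple hx.closed hy.closed (PClosed.apply _ b) hb
      obtain ⟨d, hd, hd1, hd2⟩ := hx.pair hy h1 h2
      refine ⟨d, hd, ple_trans ?_ h3⟩
      rw [map_pjoin]
      exact ple_pmeet.2 ⟨ple_trans (pmeet_ple_left _ _ _) hd1,
        ple_trans (pmeet_ple_right _ _ _) hd2⟩
    · obtain rfl := Pol.eq_of_ne_flip ht
      obtain ⟨h1, h2⟩ := pjoin_ple.1 hb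
      obtain ⟨d, hd, hd1, hd2⟩ := hx.pair hy h1 h2
      exact ⟨d, hd, pjoin_ple.2 ⟨hd1, hd2⟩⟩

theorem family {n : ℕ} {δ : Fin n → Pol} {x : Fin n → C} {T : A → Fin n → C}
    (h : ∀ i, Approximates e r κ (δ i) (x i) fun a => T a i) {a : Fin n → A}
    (ha : ∀ i, ple (δ i) (x i) (e (a i))) :
    ∃ d, ple r κ (e d) ∧ ∀ i, ple (δ i) (T d i) (e (a i)) := by
  obtain ⟨d, hd, hda⟩ := exists_common_bound (e := e) (r := r) (κ := κ) Finset.univ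
    (fun i d => ple (δ i) (T d i) (e (a i)))
    (fun i a b hab hb => ple_trans ((h i).mono a b hab) hb) fun i _ => (h i).approx _ (ha i)
  exact ⟨d, hd, fun i => hda i (Finset.mem_univ i)⟩

theorem canOp (he : IsCanonicalExtension e) (c : L.Conn) {x : Fin (L.ar c) → C}
    {T : A → Fin (L.ar c) → C}
    (h : ∀ i, Approximates e r κ (s.mul (L.eps c i)) (x i) fun a => T a i) :
    Approximates e r κ s (𝔸.canOp e c x) fun a => 𝔸.canOp e c (T a) where
  closed := pclosed_canOp 𝔸 he c fun i => (h i).closed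
  mono a b hab := starOp_mono 𝔸 e (.base c) s _ _ fun i => (h i).mono a b hab
  approx b hb := by
    obtain ⟨a, ha, hab⟩ :=
      exists_ple_of_canOp_ple 𝔸 he c (fun i => (h i).closed) (PClosed.apply _ b) hb
    obtain ⟨d, hd, hda⟩ := family h ha
    refine ⟨d, hd, ple_trans ?_ hab⟩
    rw [← canOp_map he]
    exact starOp_mono 𝔸 e (.base c) s _ _ hda

theorem resOp (he : IsCanonicalExtension e) (c : L.Conn) (i : Fin (L.ar c))
    (hs : s = ((L.fam c).mul (L.eps c i)).flip) {x : Fin (L.ar c) → C}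
    {T : A → Fin (L.ar c) → C}
    (h : ∀ j, Approximates e r κ (s.mul (L.star.eps (StarConn.res c i) j)) (x j) fun a => T a j) :
    Approximates e r κ s (resOp 𝔸 e c i x) fun a => ALBA.resOp 𝔸 e c i (T a) := by
  have hi : s.mul (L.star.eps (StarConn.res c i) i) = (L.fam c).flip := by
    rw [hs, flip_mul, mul_eps_res_self]
  have hj : ∀ j, j ≠ i →
      s.mul (L.star.eps (StarConn.res c i) j) = (L.fam c).mul (L.eps c j) := by
    intro j hji
    rw [hs, flip_mul, mul_eps_res_of_ne c hji, Pol.flip_flip]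
  have hic : PClosed e (L.fam c).flip (x i) := hi ▸ (h i).closed
  have hjc : ∀ j, j ≠ i → PClosed e ((L.fam c).mul (L.eps c j)) (x j) :=
    fun j hji => hj j hji ▸ (h j).closed
  refine ⟨?_, fun a b hab => ?_, fun b hb => ?_⟩
  · rw [hs]
    exact pclosed_resOp 𝔸 he c i hic hjc
  · exact starOp_mono 𝔸 e (.res c i) s _ _ fun j => (h j).mono a b hab
  · rw [hs, ple_flip] at hb
    simp only [hs, ple_flip]
    rcases exists_of_ple_resOp 𝔸 he c i hic hjc (PClosed.apply _ b) hb with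
      h0 | ⟨a, d, hba, hxa, had, hdx⟩
    · exact ⟨pzero r.flip, by rw [map_pzero]; exact ple_pone _ _, by rw [h0]; exact pzero_ple _ _⟩
    · obtain ⟨a', hai, haj⟩ : ∃ a' : Fin (L.ar c) → A, a' i = d ∧ ∀ j, j ≠ i → a' j = a j :=
        ⟨Function.update a i d, by simp, fun j hji => by simp [hji]⟩
      obtain ⟨d', hd', hda⟩ := family (a := a') h fun j => by
        by_cases hji : j = i
        · rw [hji, hi, hai]
          simpa using hdx
        · rw [hj j hji, haj j hji]
          exact hxa j hji
      have hdi : ple (L.fam c) (e d) (T d' i) := by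
        have := hda i
        rw [hi, hai] at this
        simpa using this
      refine ⟨d', hd', ple_pSup (ple_trans ?_ (ple_trans had hdi))⟩
      rw [← canOp_map he]
      refine canOp_mono 𝔸 c fun j => ?_
      by_cases hji : j = i
      · subst hji
        simpa using hba
      · have := hda j
        rw [hj j hji, haj j hji] at this
        simpa [hji] using this

end Approximates

/-! ## Assignments -/

/-- Nominals are interpreted as closed elements and co-nominals as open elements. -/
def Special (e : BoundedLatticeHom A C) (v : PVar → C) : Prop :=
  ∀ s n, PClosed e s (v (special s n))

/-- An admissible assignment: moreover, propositional variables take values in `A`. -/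
def Admissible (e : BoundedLatticeHom A C) (v : PVar → C) : Prop :=
  Special e v ∧ ∀ p, ∃ a, v (.prop p) = e a

theorem Special.update_prop {v : PVar → C} (hv : Special e v) (p : ℕ) (x : C) :
    Special e (Function.update v (.prop p) x) := by
  intro s n
  cases s
  · exact hv .pos n
  · exact hv .neg n

theorem Special.update_special {v : PVar → C} (hv : Special e v) {s : Pol} (n : ℕ) {x : C}
    (hx : PClosed e s x) : Special e (Function.update v (special s n) x) := by
  intro t m
  by_cases h : special t m = special s n
  · rw [h, Function.update_self]
    cases s <;> cases t <;> first | exact hx | cases h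
  · rw [Function.update_of_ne h]
    exact hv t m

theorem Admissible.update {v : PVar → C} (hv : Admissible e v) (p : ℕ) (a : A) :
    Admissible e (Function.update v (.prop p) (e a)) := by
  refine ⟨hv.1.update_prop p _, fun q => ?_⟩
  by_cases hq : q = p
  · subst hq
    exact ⟨a, by simp⟩
  · obtain ⟨b, hb⟩ := hv.2 q
    exact ⟨b, by simpa [hq] using hb⟩

theorem Admissible.pclosed_var {v : PVar → C} (hv : Admissible e v) {s : Pol} {x : PVar}
    (hx : CloVar s x) : PClosed e s (v x) := by
  cases x with
  | prop p =>
    obtain ⟨a, ha⟩ := hv.2 p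
    rw [ha]
    exact PClosed.apply s a
  | nom n =>
    obtain rfl : s = .pos := hx
    exact hv.1 .pos n
  | conom n =>
    obtain rfl : s = .neg := hx
    exact hv.1 .neg n

/-- The intersection lemma. -/
theorem Term.Clo.approximates (he : IsCanonicalExtension e) {v : PVar → C} (hv : Admissible e v)
    (p : ℕ) {r : Pol} {κ : C} (hκ : PClosed e r κ) {t : FormP L} {s : Pol} (ht : t.Clo s)
    (hp : ¬ t.Occ (s.mul r).flip (.prop p)) :
    Approximates e r κ s (t.eval (starOp 𝔸 e) (Function.update v (.prop p) κ))
      fun a => t.eval (starOp 𝔸 e) (Function.update v (.prop p) (e a)) := by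
  induction t generalizing s with
  | var y =>
    by_cases hy : y = .prop p
    · subst hy
      have : r = s := by
        cases s <;> cases r <;> first | rfl | exact absurd ⟨rfl, rfl⟩ hp
      subst this
      simpa [Term.eval] using Approximates.self hκ
    · simpa [Term.eval, hy] using Approximates.const (hv.pclosed_var ht)
  | bot =>
    exact Approximates.const (by
      simpa [Term.eval, map_bot] using PClosed.apply (e := e) s ⊥)
  | top =>
    exact Approximates.const (by
      simpa [Term.eval, map_top] using PClosed.apply (e := e) s ⊤)
  | inf a b iha ihb =>
    exact (iha ht.1 fun h => hp (Or.inl h)).pjoin he .neg (ihb ht.2 fun h => hp (Or.inr h))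
  | sup a b iha ihb =>
    exact (iha ht.1 fun h => hp (Or.inl h)).pjoin he .pos (ihb ht.2 fun h => hp (Or.inr h))
  | app c args ih =>
    have key : ∀ i, Approximates e r κ (s.mul (L.star.eps c i))
        ((args i).eval (starOp 𝔸 e) (Function.update v (.prop p) κ))
        fun a => (args i).eval (starOp 𝔸 e) (Function.update v (.prop p) (e a)) := by
      refine fun i => ih i (ht.2 i) fun h => hp ⟨i, ?_⟩
      have : (L.star.eps c i).mul (s.mul r).flip = ((s.mul (L.star.eps c i)).mul r).flip := by
        cases s <;> cases r <;> cases L.star.eps c i <;> rfl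
      rwa [this]
    rcases c with c | ⟨c, hc⟩ | ⟨c, i⟩
    · exact Approximates.canOp 𝔸 he c key
    · exact ht.1.elim
    · exact Approximates.resOp 𝔸 he c i ht.1 key

theorem Term.Clo.pclosed (he : IsCanonicalExtension e) {v : PVar → C} (hv : Admissible e v)
    {t : FormP L} {s : Pol} (ht : t.Clo s) : PClosed e s (t.eval (starOp 𝔸 e) v) := by
  induction t generalizing s with
  | var y => exact hv.pclosed_var ht
  | bot => simpa [Term.eval, map_bot] using PClosed.apply (e := e) s ⊥
  | top => simpa [Term.eval, map_top] using PClosed.apply (e := e) s ⊤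
  | inf a b iha ihb => exact he.pclosed_pjoin .neg (iha ht.1) (ihb ht.2)
  | sup a b iha ihb => exact he.pclosed_pjoin .pos (iha ht.1) (ihb ht.2)
  | app c args ih =>
    have key := fun i => ih i (ht.2 i)
    rcases c with c | ⟨c, hc⟩ | ⟨c, i⟩
    · exact pclosed_canOp 𝔸 he c key
    · exact ht.1.elim
    -- Only closedness is wanted, so constant approximations and the dummy value `⊥` suffice.
    · exact (Approximates.resOp (r := .pos) (κ := ⊥) 𝔸 he c i ht.1
        fun j => Approximates.const (key j)).closed

end Star

section Soundness

variable {L : Sig.{w}} {A : Type u} {C : Type v} [Lattice A] [BoundedOrder A] [CompleteLattice C]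
  (𝔸 : LEAlgebra L A) {e : BoundedLatticeHom A C}

/-! ## Evaluation of formulas of the original language -/

theorem Term.eval_emb (t : Form L) (v : PVar → C) :
    t.emb.eval (starOp 𝔸 e) v = t.eval (𝔸.canOp e) fun n => v (.prop n) := by
  induction t with
  | var x => rfl
  | bot => rfl
  | top => rfl
  | inf a b iha ihb => exact congrArg₂ (· ⊓ ·) iha ihb
  | sup a b iha ihb => exact congrArg₂ (· ⊔ ·) iha ihb
  | app c args ih => exact congrArg (𝔸.canOp e c) (funext ih)

theorem Term.eval_canOp_map (he : IsCanonicalExtension e) (t : Form L) (v : ℕ → A) :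
    (t.eval (𝔸.canOp e) fun n => e (v n)) = e (t.eval 𝔸.op v) := by
  induction t with
  | var x => rfl
  | bot => exact (map_bot e).symm
  | top => exact (map_top e).symm
  | inf a b iha ihb => exact (congrArg₂ (· ⊓ ·) iha ihb).trans (map_inf e _ _).symm
  | sup a b iha ihb => exact (congrArg₂ (· ⊔ ·) iha ihb).trans (map_sup e _ _).symm
  | app c args ih =>
    exact (congrArg (𝔸.canOp e c) (funext ih)).trans (canOp_map he 𝔸 c _)

theorem eval_appBase (c : L.Conn) (φ : Fin (L.ar c) → FormP L) (v : PVar → C) :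
    (appBase c φ).eval (starOp 𝔸 e) v = 𝔸.canOp e c fun j => (φ j).eval (starOp 𝔸 e) v := rfl

theorem eval_appRes (c : L.Conn) (i : Fin (L.ar c)) (φ : Fin (L.ar c) → FormP L) (v : PVar → C) :
    (appRes c i φ).eval (starOp 𝔸 e) v = resOp 𝔸 e c i fun j => (φ j).eval (starOp 𝔸 e) v := rfl

/-! ## Systems under an assignment -/

/-- Under the assignment `v`, the inequalities of the system imply its goal. -/
def System.Holds (𝔸 : LEAlgebra L A) (e : BoundedLatticeHom A C) (T : System L) (v : PVar → C) :
    Prop :=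
  (∀ q ∈ T.S, q.Sat (starOp 𝔸 e) v) → T.goal.Sat (starOp 𝔸 e) v

/-- The left-hand side is syntactically closed and the right-hand side syntactically open. -/
def Ineq.Clo (q : IneqP L) : Prop := q.lhs.Clo .pos ∧ q.rhs.Clo .neg

theorem Ineq.clo_of {s : Pol} {a b : FormP L} : (Ineq.of s a b).Clo ↔ a.Clo s ∧ b.Clo s.flip := by
  cases s
  · exact Iff.rfl
  · exact and_comm

theorem Ineq.occurs_of {s : Pol} {a b : FormP L} {x : PVar} :
    (Ineq.of s a b).Occurs x ↔ a.Occurs x ∨ b.Occurs x := by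
  cases s
  · exact Iff.rfl
  · exact or_comm

/-- The systems that arise from initial ones by reduction. -/
def System.Regular (T : System L) : Prop := T.S.Finite ∧ ∀ q ∈ T.S, q.Clo

/-! ## Contexts -/

theorem SACContext.eval_mono {s s' : Pol} {Φ : FormP L → FormP L} (h : SACContext s s' Φ)
    {t t' : FormP L} {v : PVar → C}
    (ht : ple s' (t.eval (starOp 𝔸 e) v) (t'.eval (starOp 𝔸 e) v)) :
    ple s ((Φ t).eval (starOp 𝔸 e) v) ((Φ t').eval (starOp 𝔸 e) v) := by
  induction h with
  | hole s => exact ht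
  | node s s' c hc φ i Φ _ ih =>
    subst hc
    rw [eval_appBase, eval_appBase, Term.eval_update, Term.eval_update]
    exact canOp_mono 𝔸 c (ple_update (ih ht) fun j _ => ple_refl _ _)

/-- An SAC context acts on values as a function that preserves nonempty joins. -/
theorem SACContext.exists_eval_eq (he : IsCanonicalExtension e) {s s' : Pol}
    {Φ : FormP L → FormP L} (h : SACContext s s' Φ) {γ : FormP L} {y : PVar}
    (hy : ¬ (Φ γ).Occurs y) (v : PVar → C) :
    ∃ E : C → C,
      (∀ (u : C) (t : FormP L), (Φ t).eval (starOp 𝔸 e) (Function.update v y u) =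
        E (t.eval (starOp 𝔸 e) (Function.update v y u))) ∧
      ∀ (X : Set C) (z : C), X.Nonempty → (∀ u ∈ X, ple s (E u) z) → ple s (E (pSup s' X)) z := by
  induction h with
  | hole s => exact ⟨id, fun _ _ => rfl, fun X z _ h => pSup_ple h⟩
  | node s s' c hc φ i Φ _ ih =>
    subst hc
    have hocc : ∀ j, ¬ (Function.update φ i (Φ γ) j).Occurs y := by
      rintro j ⟨r, hr⟩
      refine hy ⟨(L.eps c j).mul r, j, ?_⟩
      have : (L.eps c j).mul ((L.eps c j).mul r) = r := Pol.mul_mul_cancel _ _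
      change Term.Occ _ ((L.eps c j).mul ((L.eps c j).mul r)) _
      rwa [this]
    obtain ⟨E, hE, hEX⟩ := ih (by simpa using hocc i)
    -- The side arguments do not contain `y`, so their values stay fixed while `y` varies.
    let x : Fin (L.ar c) → C := fun j => (φ j).eval (starOp 𝔸 e) v
    refine ⟨fun u => 𝔸.canOp e c (Function.update x i (E u)), fun u t => ?_, fun X z hX hz => ?_⟩
    · rw [eval_appBase]
      refine congrArg (𝔸.canOp e c) (funext fun j => ?_)
      by_cases hj : j = i
      · subst hj
        simpa using hE u t
      · have := hocc j
        rw [Function.update_of_ne hj] at this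
        simpa [hj, x] using Term.eval_update_of_not_occurs this v u
    · have h1 : ple ((L.fam c).mul (L.eps c i)) (E (pSup s' X))
          (pSup ((L.fam c).mul (L.eps c i)) (E '' X)) :=
        hEX X _ hX fun u hu => ple_pSup ⟨u, hu, rfl⟩
      refine ple_trans (canOp_mono 𝔸 c (ple_update h1 fun j _ => ple_refl _ _))
        (canOp_update_pSup_ple he 𝔸 c x i (hX.image E) ?_)
      rintro _ ⟨u, hu, rfl⟩
      exact hz u hu

/-- This is what makes approximation invertible: the value of `γ` is the join of the closed elements
below it, and the context preserves this join. -/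
theorem SACContext.eval_ple (he : IsCanonicalExtension e) {s s' : Pol}
    {Φ : FormP L → FormP L} (h : SACContext s s' Φ) {γ : FormP L} {y : PVar}
    (hy : ¬ (Φ γ).Occurs y) (v : PVar → C) {z : C}
    (hz : ∀ k, PClosed e s' k → ple s' k (γ.eval (starOp 𝔸 e) v) →
      ple s ((Φ (.var y)).eval (starOp 𝔸 e) (Function.update v y k)) z) :
    ple s ((Φ γ).eval (starOp 𝔸 e) v) z := by
  obtain ⟨E, hE, hEX⟩ := h.exists_eval_eq 𝔸 he hy v
  have hγX : γ.eval (starOp 𝔸 e) v =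
      pSup s' {k | PClosed e s' k ∧ ple s' k (γ.eval (starOp 𝔸 e) v)} :=
    ple_antisymm (s := s') (he.ple_of_forall_closed fun k hk hkγ => ple_pSup ⟨hk, hkγ⟩)
      (pSup_ple fun k hk => hk.2)
  have hv : (Φ γ).eval (starOp 𝔸 e) v = E (γ.eval (starOp 𝔸 e) v) := by
    simpa using hE (v y) γ
  rw [hv, hγX]
  -- The least element is closed, so the join is nonempty even when `γ` is least.
  refine hEX _ _ ⟨pzero s', by rw [← map_pzero (e := e)]; exact PClosed.apply _ _,
    pzero_ple _ _⟩ ?_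
  rintro k ⟨hk, hkγ⟩
  have := hz k hk hkγ
  rw [hE] at this
  simpa [Term.eval] using this

/-! ## The reduction rules under an assignment -/

theorem Term.not_occurs_emb_special (t : Form L) (s : Pol) (n : ℕ) :
    ¬ t.emb.Occurs (special s n) := by
  rintro ⟨r, hr⟩
  induction t generalizing r with
  | var x => cases s <;> cases hr.2
  | bot => exact hr
  | top => exact hr
  | inf a b iha ihb => exact hr.elim (iha r) (ihb r)
  | sup a b iha ihb => exact hr.elim (iha r) (ihb r)
  | app c args ih =>
    obtain ⟨i, hi⟩ := hr
    exact ih i _ hi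

theorem forall_mem_replace_iff {α : Type*} {S : Set α} {q a b : α} {P : α → Prop} (hq : q ∈ S)
    (h : P q ↔ P a ∧ P b) : (∀ x ∈ insert a (insert b (S \ {q})), P x) ↔ ∀ x ∈ S, P x := by
  constructor
  · intro H x hx
    by_cases hxq : x = q
    · subst hxq
      exact h.2 ⟨H a (Or.inl rfl), H b (Or.inr (Or.inl rfl))⟩
    · exact H x (Or.inr (Or.inr ⟨hx, hxq⟩))
  · rintro H x (rfl | rfl | ⟨hx, -⟩)
    · exact (h.1 (H q hq)).1
    · exact (h.1 (H q hq)).2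
    · exact H x hx

theorem sat_residuation (he : IsCanonicalExtension e) (c : L.Conn) (hc : ¬ L.reg c)
    (φ : Fin (L.ar c) → FormP L) (ψ : FormP L) (i : Fin (L.ar c)) (v : PVar → C) :
    (Ineq.of (L.fam c) (appBase c φ) ψ).Sat (starOp 𝔸 e) v ↔
      (Ineq.of ((L.fam c).mul (L.eps c i)) (φ i)
        (appRes c i (Function.update φ i ψ))).Sat (starOp 𝔸 e) v := by
  rw [Ineq.sat_of, Ineq.sat_of, eval_appBase, eval_appRes, Term.eval_update]
  exact canOp_ple_iff_of_normal 𝔸 he c hc i _ _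

theorem sat_adjunction (he : IsCanonicalExtension e) (c : L.Conn) (hc : L.reg c)
    (φ : Fin (L.ar c) → FormP L) (ψ : FormP L) (i : Fin (L.ar c)) (v : PVar → C) :
    (Ineq.of (L.fam c) (appBase c φ) ψ).Sat (starOp 𝔸 e) v ↔
      (Ineq.of (L.fam c) (appBase c fun _ => Term.zero ((L.fam c).mul (L.eps c i)))
        ψ).Sat (starOp 𝔸 e) v ∧
      (Ineq.of ((L.fam c).mul (L.eps c i)) (φ i) (appRes c i fun _ => ψ)).Sat (starOp 𝔸 e) v := by
  -- Regular connectives are unary, so updating the only coordinate gives a constant tuple.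
  have hsub : ∀ j, j = i := by
    have := L.ar_reg c hc
    intro j
    ext
    omega
  have hconst : ∀ (x : Fin (L.ar c) → C) (a : C), Function.update x i a = fun _ => a := by
    intro x a
    funext j
    rw [hsub j, Function.update_self]
  rw [Ineq.sat_of, Ineq.sat_of, Ineq.sat_of, eval_appBase, eval_appBase, eval_appRes,
    canOp_ple_iff 𝔸 he c i, hconst, hconst]
  simp only [Term.eval_zero]

/-- When `ψ` changes places with the `i`-th argument, the residual's order-type leaves each
subformula with its old sign, and the residual itself stands on the side that `CloConn` allows. The
general `χ` covers residuation and adjunction alike. -/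
theorem clo_residuation {c : L.Conn} {φ : Fin (L.ar c) → FormP L} {ψ : FormP L}
    (h : (Ineq.of (L.fam c) (appBase c φ) ψ).Clo) (i : Fin (L.ar c))
    {χ : Fin (L.ar c) → FormP L} (hi : χ i = ψ) (hj : ∀ j, j ≠ i → χ j = φ j) :
    (Ineq.of ((L.fam c).mul (L.eps c i)) (φ i) (appRes c i χ)).Clo := by
  rw [Ineq.clo_of] at h ⊢
  refine ⟨h.1.2 i, rfl, fun j => ?_⟩
  rw [flip_mul]
  by_cases hji : j = i
  · rw [hji, mul_eps_res_self, hi]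
    exact h.2
  · rw [mul_eps_res_of_ne c hji, Pol.flip_flip, hj j hji]
    exact h.1.2 j

/-- The topological Ackermann lemma. -/
theorem exists_sat_of_sat_update (he : IsCanonicalExtension e) {v : PVar → C}
    (hv : Admissible e v) {R : Set (IneqP L)} (hR : R.Finite) (hclo : ∀ q ∈ R, q.Clo)
    {p : ℕ} {s : Pol} (hl : ∀ q ∈ R, ¬ q.lhs.Occ s.flip (.prop p))
    (hr : ∀ q ∈ R, ¬ q.rhs.Occ s (.prop p)) {κ : C} (hκ : PClosed e s κ)
    (h : ∀ q ∈ R, q.Sat (starOp 𝔸 e) (Function.update v (.prop p) κ)) :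
    ∃ a, ple s κ (e a) ∧
      ∀ q ∈ R, q.Sat (starOp 𝔸 e) (Function.update v (.prop p) (e a)) := by
  have hL : ∀ q ∈ R, _ := fun q hq =>
    (hclo q hq).1.approximates 𝔸 he hv p hκ (by simpa using hl q hq)
  have hU : ∀ q ∈ R, _ := fun q hq =>
    (hclo q hq).2.approximates 𝔸 he hv p hκ (by simpa using hr q hq)
  have hmono : ∀ q ∈ R, ∀ a b, ple s a b →
      q.Sat (starOp 𝔸 e) (Function.update v (.prop p) (e b)) →
      q.Sat (starOp 𝔸 e) (Function.update v (.prop p) (e a)) := fun q hq a b hab hb =>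
    le_trans ((hL q hq).mono a b hab) (le_trans hb ((hU q hq).mono a b hab))
  -- The guard `q ∈ R` makes the predicate hereditary at every index, as `exists_common_bound`
  -- demands.
  obtain ⟨a, ha, haR⟩ := exists_common_bound (e := e) (r := s) (κ := κ) hR.toFinset
    (fun q a => q ∈ R → q.Sat (starOp 𝔸 e) (Function.update v (.prop p) (e a)))
    (fun q a b hab hb hq => hmono q hq a b hab (hb hq)) fun q hq => by
      rw [Set.Finite.mem_toFinset] at hq
      -- The left value is closed and the right one open, so some `b` in $\mathbb A$ separates them.
      -- Each side is approximated up to `b`, and the two approximants are combined.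
      obtain ⟨b, hb1, hb2⟩ :=
        he.exists_between (s := .pos) (hL q hq).closed (hU q hq).closed (h q hq)
      obtain ⟨a₁, h1, hab1⟩ := (hL q hq).approx b hb1
      obtain ⟨a₂, h2, hab2⟩ := (hU q hq).approx b hb2
      refine ⟨pjoin s.flip a₁ a₂, by rw [map_pjoin]; exact ple_pmeet.2 ⟨h1, h2⟩, fun _ => ?_⟩
      exact le_trans ((hL q hq).mono _ _ (pmeet_ple_left _ _ _))
        (le_trans (le_trans hab1 hab2) ((hU q hq).mono _ _ (pmeet_ple_right _ _ _)))
  exact ⟨a, ha, fun q hq => haR q (hR.mem_toFinset.2 hq) hq⟩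

/-! ### The Ackermann rules in both directions. -/

section Ackermann

variable {S D R : Set (IneqP L)} {I : IneqP L} {p : ℕ} {s : Pol} {αs : List (FormP L)}
  (hS : S = {q | ∃ α ∈ αs, q = Ineq.of s α (.var (.prop p))} ∪ R)
include hS

theorem System.Regular.ackermann {D' : Set (IneqP L)} (hl : ∀ q ∈ R, ¬ q.lhs.Occ s.flip (.prop p))
    (hr : ∀ q ∈ R, ¬ q.rhs.Occ s (.prop p)) (h : System.Regular ⟨S, D, I⟩) :
    System.Regular ⟨(fun q => q.subst1 (.prop p) (Term.bigJoin s αs)) '' R, D', I⟩ := by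
  subst hS
  have hα : (Term.bigJoin s αs).Clo s := Term.clo_bigJoin fun α hα =>
    (Ineq.clo_of.1 (h.2 _ (Or.inl ⟨α, hα, rfl⟩))).1
  refine ⟨(h.1.subset Set.subset_union_right).image _, ?_⟩
  rintro _ ⟨q, hq, rfl⟩
  have hqc := h.2 q (Or.inr hq)
  exact ⟨hqc.1.subst1 (by simpa using hl q hq) hα, hqc.2.subst1 (by simpa using hr q hq) hα⟩

/-- The eliminated variable needs a value in $\mathbb A$. The element from
`exists_sat_of_sat_update` is one: it bounds the `αs` and satisfies `R`. -/
theorem System.Holds.ackermann (he : IsCanonicalExtension e) {D' : Set (IneqP L)}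
    (hα : ∀ α ∈ αs, ¬ α.Occurs (.prop p)) (hI : ¬ I.Occurs (.prop p))
    (hl : ∀ q ∈ R, ¬ q.lhs.Occ s.flip (.prop p)) (hr : ∀ q ∈ R, ¬ q.rhs.Occ s (.prop p))
    (hreg : System.Regular ⟨S, D, I⟩)
    (h : ∀ v, Admissible e v → System.Holds 𝔸 e ⟨S, D, I⟩ v) {v : PVar → C}
    (hv : Admissible e v) :
    System.Holds 𝔸 e ⟨(fun q => q.subst1 (.prop p) (Term.bigJoin s αs)) '' R, D', I⟩ v := by
  subst hS
  intro hsat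
  have hαc : (Term.bigJoin s αs).Clo s := Term.clo_bigJoin fun α hα =>
    (Ineq.clo_of.1 (hreg.2 _ (Or.inl ⟨α, hα, rfl⟩))).1
  obtain ⟨a, ha, haR⟩ := exists_sat_of_sat_update 𝔸 he hv
    (hreg.1.subset Set.subset_union_right) (fun q hq => hreg.2 q (Or.inr hq)) hl hr
    (hαc.pclosed 𝔸 he hv) fun q hq => (q.sat_subst1 _ _ v).1 (hsat _ ⟨q, hq, rfl⟩)
  refine (Ineq.sat_update_of_not_occurs hI v (e a)).1 (h _ (hv.update p a) ?_)
  rintro q (⟨α, hαs, rfl⟩ | hq)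
  · rw [Ineq.sat_of, Term.eval_update_of_not_occurs (hα α hαs)]
    refine ple_trans (Term.bigJoin_ple.1 (ple_refl _ _) α hαs) ?_
    simpa [Term.eval] using ha
  · exact haR q hq

/-- The premises $\alpha_i\le p$ put the join of the $\alpha_i$ below the value of $p$, and the
remaining inequalities survive decreasing $p$. No topology is involved, so $p$ may take any value.
-/
theorem System.Holds.of_ackermann {D' : Set (IneqP L)}
    (hl : ∀ q ∈ R, ¬ q.lhs.Occ s.flip (.prop p)) (hr : ∀ q ∈ R, ¬ q.rhs.Occ s (.prop p))
    {v : PVar → C}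
    (h : System.Holds 𝔸 e ⟨(fun q => q.subst1 (.prop p) (Term.bigJoin s αs)) '' R, D', I⟩ v) :
    System.Holds 𝔸 e ⟨S, D, I⟩ v := by
  subst hS
  intro hsat
  refine h ?_
  rintro _ ⟨q, hq, rfl⟩
  rw [Ineq.sat_subst1]
  refine Ineq.Sat.of_update (starOp_mono 𝔸 e) (hl q hq) (by simpa using hr q hq)
    (a := v (.prop p)) ?_ ?_
  · simpa using hsat q (Or.inr hq)
  · rw [Function.update_self, ple_flip]
    refine Term.bigJoin_ple.2 fun α hα => ?_
    exact Ineq.sat_of.1 (hsat _ (Or.inl ⟨α, hα, rfl⟩))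

end Ackermann

/-! ## Soundness of reduction -/

theorem System.Regular.replace {S D D' : Set (IneqP L)} {I : IneqP L} {q a b : IneqP L}
    (h : System.Regular ⟨S, D, I⟩) (ha : a.Clo) (hb : b.Clo) :
    System.Regular ⟨insert a (insert b (S \ {q})), D', I⟩ := by
  refine ⟨((h.1.subset Set.sdiff_subset).insert b).insert a, ?_⟩
  rintro x (rfl | rfl | hx)
  · exact ha
  · exact hb
  · exact h.2 x hx.1

theorem Step.regular {piv safe : Prop} {T T' : System L} (h : Step piv safe T T')
    (hT : T.Regular) : T'.Regular := by
  cases h with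
  | approx S D s s' Φ γ ψ n hΦ hpiv hn =>
    refine ⟨hT.1.insert _, ?_⟩
    rintro q (rfl | hq)
    · refine Ineq.clo_of.2 ⟨?_, γ.clo_emb _⟩
      cases s' <;> rfl
    · exact hT.2 q hq
  | residuation S D I c hc φ ψ i q hq hS hsafe =>
    subst hq
    have := clo_residuation (hT.2 _ hS) i (χ := Function.update φ i ψ) (by simp)
      fun j hj => by simp [hj]
    -- Residuation yields a single inequality, inserted here twice to fit the common form.
    have h := System.Regular.replace (q := Ineq.of (L.fam c) (appBase c φ) ψ)
      (D' := D \ {Ineq.of (L.fam c) (appBase c φ) ψ}) hT this this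
    simpa using h
  | adjunction S D I c hc φ ψ i q r hq hS hsafe hr =>
    subst hq hr
    have hcl := hT.2 _ hS
    have hsub : ∀ j, j = i := by
      have := L.ar_reg c hc
      intro j
      ext
      omega
    refine hT.replace ?_ (clo_residuation hcl i rfl fun j hj => absurd (hsub j) hj)
    exact Ineq.clo_of.2 ⟨⟨trivial, fun _ => Term.clo_zero _ _⟩, (Ineq.clo_of.1 hcl).2⟩
  | split_inf S D I α β γ q hq hS hsafe =>
    subst hq
    have hcl := hT.2 _ hS
    exact hT.replace ⟨hcl.1, hcl.2.1⟩ ⟨hcl.1, hcl.2.2⟩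
  | split_sup S D I α β γ q hq hS hsafe =>
    subst hq
    have hcl := hT.2 _ hS
    exact hT.replace ⟨hcl.1.1, hcl.2⟩ ⟨hcl.1.2, hcl.2⟩
  | ackermann_right S D R I p αs hS hα hI hβ hγ =>
    exact System.Regular.ackermann (s := .pos) hS hβ hγ hT
  | ackermann_left S D R I p αs hS hα hI hβ hγ =>
    exact System.Regular.ackermann (s := .neg) hS hβ hγ hT

theorem System.holds_replace_iff {S D D' : Set (IneqP L)} {I : IneqP L} {q a b : IneqP L}
    {v : PVar → C} (hq : q ∈ S) (h : q.Sat (starOp 𝔸 e) v ↔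
      a.Sat (starOp 𝔸 e) v ∧ b.Sat (starOp 𝔸 e) v) :
    System.Holds 𝔸 e ⟨insert a (insert b (S \ {q})), D', I⟩ v ↔ System.Holds 𝔸 e ⟨S, D, I⟩ v :=
  imp_congr_left (forall_mem_replace_iff hq h)

theorem System.holds_residuation_iff (he : IsCanonicalExtension e) {S D D' : Set (IneqP L)}
    {I : IneqP L} {c : L.Conn} (hc : ¬ L.reg c) {φ : Fin (L.ar c) → FormP L} {ψ : FormP L}
    (i : Fin (L.ar c)) (hS : Ineq.of (L.fam c) (appBase c φ) ψ ∈ S) (v : PVar → C) :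
    System.Holds 𝔸 e ⟨insert (Ineq.of ((L.fam c).mul (L.eps c i)) (φ i)
        (appRes c i (Function.update φ i ψ))) (S \ {Ineq.of (L.fam c) (appBase c φ) ψ}), D', I⟩ v ↔
      System.Holds 𝔸 e ⟨S, D, I⟩ v := by
  have := System.holds_replace_iff 𝔸 (D := D) (D' := D') (I := I) hS
    ((sat_residuation 𝔸 he c hc φ ψ i v).trans (and_self_iff).symm)
  simpa using this

theorem Step.holds {piv safe : Prop} (he : IsCanonicalExtension e) {T T' : System L}
    (h : Step piv safe T T') (hT : T.Regular) (hH : ∀ v, Admissible e v → T.Holds 𝔸 e v) :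
    ∀ v, Admissible e v → T'.Holds 𝔸 e v := by
  intro v hv
  cases h with
  | approx S D s s' Φ γ ψ n hΦ hpiv hn =>
    intro hsat
    have h1 := Ineq.sat_of.1 (hH v hv fun q hq => hsat q (Or.inr hq))
    have h2 := Ineq.sat_of.1 (hsat _ (Or.inl rfl))
    -- The nominal lies below `γ`, so by monotonicity its instance of the goal is weaker.
    exact Ineq.sat_of.2 (ple_trans (hΦ.eval_mono 𝔸 h2) h1)
  | residuation S D I c hc φ ψ i q hq hS hsafe =>
    subst hq
    exact (System.holds_residuation_iff 𝔸 he hc i hS v).2 (hH v hv)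
  | adjunction S D I c hc φ ψ i q r hq hS hsafe hr =>
    subst hq hr
    exact (System.holds_replace_iff 𝔸 hS (sat_adjunction 𝔸 he c hc φ ψ i v)).2 (hH v hv)
  | split_inf S D I α β γ q hq hS hsafe =>
    subst hq
    exact (System.holds_replace_iff 𝔸 hS le_inf_iff).2 (hH v hv)
  | split_sup S D I α β γ q hq hS hsafe =>
    subst hq
    exact (System.holds_replace_iff 𝔸 hS sup_le_iff).2 (hH v hv)
  | ackermann_right S D R I p αs hS hα hI hβ hγ =>
    exact System.Holds.ackermann 𝔸 (s := .pos) hS he hα hI hβ hγ hT hH hv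
  | ackermann_left S D R I p αs hS hα hI hβ hγ =>
    exact System.Holds.ackermann 𝔸 (s := .neg) hS he hα hI hβ hγ hT hH hv

theorem Step.of_holds {piv safe : Prop} (he : IsCanonicalExtension e) {T T' : System L}
    (h : Step piv safe T T') (hH : ∀ v, Special e v → T'.Holds 𝔸 e v) :
    ∀ v, Special e v → T.Holds 𝔸 e v := by
  intro v hv
  cases h with
  | approx S D s s' Φ γ ψ n hΦ hpiv hn =>
    intro hsat
    have hn' := not_or.1 hn.1
    have hgoal := not_or.1 (mt Ineq.occurs_of.2 hn'.1)
    have hγ := Term.not_occurs_emb_special γ s' n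
    -- The fresh nominal runs through all closed `k` below `γ`; freshness keeps `S` and `ψ`
    -- unaffected.
    refine Ineq.sat_of.2 (hΦ.eval_ple 𝔸 he hgoal.1 v fun k hk hkγ => ?_)
    have := Ineq.sat_of.1 (hH (Function.update v (special s' n) k) (hv.update_special n hk) ?_)
    · rwa [Term.eval_update_of_not_occurs hgoal.2] at this
    · rintro q (rfl | hq)
      · rw [Ineq.sat_of, Term.eval_update_of_not_occurs hγ]
        simpa [Term.eval] using hkγ
      · exact (Ineq.sat_update_of_not_occurs (fun ho => hn'.2 ⟨q, hq, ho⟩) v k).2 (hsat q hq)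
  | residuation S D I c hc φ ψ i q hq hS hsafe =>
    subst hq
    exact (System.holds_residuation_iff 𝔸 he hc i hS v).1 (hH v hv)
  | adjunction S D I c hc φ ψ i q r hq hS hsafe hr =>
    subst hq hr
    exact (System.holds_replace_iff 𝔸 hS (sat_adjunction 𝔸 he c hc φ ψ i v)).1 (hH v hv)
  | split_inf S D I α β γ q hq hS hsafe =>
    subst hq
    exact (System.holds_replace_iff 𝔸 hS le_inf_iff).1 (hH v hv)
  | split_sup S D I α β γ q hq hS hsafe =>
    subst hq
    exact (System.holds_replace_iff 𝔸 hS sup_le_iff).1 (hH v hv)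
  | ackermann_right S D R I p αs hS hα hI hβ hγ =>
    exact System.Holds.of_ackermann 𝔸 (s := .pos) hS hβ hγ (hH v hv)
  | ackermann_left S D R I p αs hS hα hI hβ hγ =>
    exact System.Holds.of_ackermann 𝔸 (s := .neg) hS hβ hγ (hH v hv)

/-! ## Canonicity -/

/-- For pure systems, admissible assignments suffice. -/
theorem System.Pure.holds {T : System L} (hT : T.Pure)
    (h : ∀ v, Admissible e v → T.Holds 𝔸 e v) : ∀ v, Special e v → T.Holds 𝔸 e v := by
  intro v hv
  -- Resetting the propositional variables to an element of $\mathbb A$ makes the assignment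
  -- admissible and is invisible to a pure system.
  let v' : PVar → C := fun x => match x with
    | .prop _ => e ⊥
    | .nom n => v (.nom n)
    | .conom n => v (.conom n)
  have hv' : Admissible e v' := by
    refine ⟨fun s n => ?_, fun p => ⟨⊥, rfl⟩⟩
    cases s
    · exact hv .pos n
    · exact hv .neg n
  have hvv : ∀ x, T.Occurs x → v' x = v x := by
    rintro (p | n | n) hx
    · exact absurd hx (hT p)
    · rfl
    · rfl
  intro hsat
  refine (Ineq.sat_congr fun x hx => hvv x (Or.inl hx)).1 (h v' hv' fun q hq => ?_)
  exact (Ineq.sat_congr fun x hx => hvv x (Or.inr ⟨q, hq, hx⟩)).2 (hsat q hq)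

/-- The three sides of the U: `hfwd` descends with admissible assignments, `System.Pure.holds`
crosses over, `hbwd` ascends with special ones. -/
theorem valid_canOp_of_reduces {piv safe : Prop} (he : IsCanonicalExtension e) {r : Ineq L ℕ}
    {T : System L} (h : Relation.ReflTransGen (Step piv safe) (System.init r) T) (hT : T.Pure)
    (hr : r.Valid 𝔸.op) : r.Valid (𝔸.canOp e) := by
  have hinit : ∀ v, Admissible e v → (System.init r).Holds 𝔸 e v := by
    intro v hv _
    choose a ha using hv.2
    change r.lhs.emb.eval (starOp 𝔸 e) v ≤ r.rhs.emb.eval (starOp 𝔸 e) v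
    rw [Term.eval_emb, Term.eval_emb, funext ha, Term.eval_canOp_map 𝔸 he,
      Term.eval_canOp_map 𝔸 he]
    exact OrderHomClass.mono e (hr a)
  have hfwd : T.Regular ∧ ∀ v, Admissible e v → T.Holds 𝔸 e v := by
    clear hT
    induction h with
    | refl => exact ⟨⟨Set.finite_empty, fun _ hq => absurd hq (Set.notMem_empty _)⟩, hinit⟩
    | tail _ hstep ih => exact ⟨hstep.regular ih.1, hstep.holds 𝔸 he ih.1 ih.2⟩
  have hbwd : ∀ v, Special e v → (System.init r).Holds 𝔸 e v := by
    have hlast := hT.holds 𝔸 hfwd.2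
    clear hT hfwd hinit
    generalize System.init r = T₀ at h ⊢
    induction h using Relation.ReflTransGen.head_induction_on with
    | refl => exact hlast
    | head hstep _ ih => exact hstep.of_holds 𝔸 he ih
  intro v
  -- The initial system contains no nominals or co-nominals; `e ⊥` is both closed and open.
  let v' : PVar → C := fun x => match x with
    | .prop n => v n
    | _ => e ⊥
  have hv' : Special e v' := by
    intro s n
    cases s <;> exact PClosed.apply _ _
  have : r.lhs.emb.eval (starOp 𝔸 e) v' ≤ r.rhs.emb.eval (starOp 𝔸 e) v' :=
    hbwd v' hv' fun _ hq => absurd hq (Set.notMem_empty _)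
  rwa [Term.eval_emb, Term.eval_emb] at this

end Soundness

end ALBA

theorem mainTheorem2 (L : ALBA.Sig.{w}) (q : ALBA.Ineq L ℕ)
    (h : ALBA.Succeeds True True q) : ALBA.Canonical.{w, u, v} q := by
  intro A _ _ 𝔸 C _ e he hq
  obtain ⟨Q, hQ, hred⟩ := h
  -- Preprocessing is undone in $\mathbb A^\delta$, which is itself an $\mathcal L$-algebra.
  refine (hQ.valid_iff (𝔸.can he)).2 fun r hr => ?_
  obtain ⟨T, hT, hpure⟩ := hred r hr
  exact ALBA.valid_canOp_of_reduces 𝔸 he hT hpure ((hQ.valid_iff 𝔸).1 hq r hr)
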